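/- Let $d\in\mathbb N$, $\mathcal X=[0,1]^d$ with the Euclidean distance, and $\mathcal Y=\{0,1\}$ ($M=2$ labels). A cost-sensitive problem is a probability measure $P$ on $\mathcal X\times[0,1]^{2}$, the law of $(X,c)$ with $c=(c(0),c(1))$, together with a version of the conditional law of $c$ given $X=x$ for every $x\in\mathcal X$. Put $f(x;y)=\mathbb E(c(y)\mid X=x)$, $R_{cs}(g)=\mathbb E\,c(g(X))$ for $g:\mathcal X\to\mathcal Y$, and let $f^*_{cs}(x)\in\arg\min_{y}f(x;y)$. Let $\Delta(x,y)=f(x;y)-\min_{y'}f(x;y')$, let $\Delta(x)$ be the smallest positive value among the $\Delta(x,y)$, $y\in\mathcal Y$ ($\Delta(x)=\infty$ if there is none), and let $\Delta'(x)$ be the difference of the second smallest and the smallest of the values $f(x;y)$, counted with multiplicity. For $\zeta=(\alpha,L,\beta,C_\beta,C'_\beta,\tau,\mu_{\min},\mu_{\max})\in(0,1)\times(0,\infty)^4\times[0,1]\times(0,1)\times(0,\infty)$ let $\mathcal P_{cs}(\zeta)$ be the class of such $P$ with: (a) $|f(x;y)-f(z;y)|\le L\|x-z\|^\alpha$ for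 all $y\in\mathcal Y$, $x,z\in\mathcal X$; (b) for all $\epsilon>0$, $P_X(\Delta(X)\le\epsilon)\le C_\beta\epsilon^\beta$ and $P_X(\Delta'(X)\le\epsilon)\le\tau+C'_\beta\epsilon^\beta$; (c) $P_X$ has a density $p_X$ on $\mathcal X$ such that $\mu_{\min}\le p_X(x)\le\mu_{\max}$ whenever $p_X(x)>0$. An active learning algorithm with budget $n$ chooses successively points $X_1,\dots,X_n\in\mathcal X$, where $X_{t+1}$ is a measurable function of the past $(X_1,c_1),\dots,(X_t,c_t)$ and of internal randomness (whose law may depend on $P_X$; unlabelled data are allowed). Given the past and $X_{t+1}=x$, the observed cost vector $c_{t+1}$ has the conditional law of $c$ given $X=x$. The algorithm then returns a classifier $\hat g_n:\mathcal X\to\{0,1\}$ that depends measurably on $S_n=\{(X_1,c_1),\dots,(X_n,c_n)\}$ and on the internal randomness. **Theorem.** Assume that $L,C_\beta,C'_\beta>1$, $\alpha\beta\le d$, $\mu_{\min}<\tau$ and $\mu_{\max}>1$. Then there exist constants $C_{cs},C'_{cs}>0$, independent of $n$, such that for all $n\ge1$ $$\inf_{\hat g_n}\ \sup_{P\in\mathcal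 P_{cs}(\zeta)}\ \mathbb E\bigl(R_{cs}(\hat g_n)-R_{cs}(f^*_{cs})\bigr)\ \ge\ \min(a_{n,\tau},a'_{n,\tau}),$$ where the infimum is over all active learning algorithms with budget $n$, $$a_{n,\tau}=C_{cs}\max\left(\Bigl(\frac{\tau}{n}\Bigr)^{\frac{\alpha(\beta+1)}{2\alpha+d}},\ \Bigl(\frac1n\Bigr)^{\frac{\alpha(\beta+1)}{2\alpha+d-\alpha\beta}}\right)$$ and $$a'_{n,\tau}=C'_{cs}\max\left(\Bigl(\frac1n\Bigr)^{\frac{\alpha(\beta+1)}{2\alpha+d}},\ \Bigl(\frac1\tau\Bigr)^{\frac{\alpha(\beta+1)}{2\alpha+d}}\Bigl(\frac1n\Bigr)^{\frac{\alpha(\beta+1)}{2\alpha+d-\alpha\beta}}\right).$$ -/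

import Mathlib

open MeasureTheory ProbabilityTheory

namespace CostSensitive

/-- The instance space `[0,1]^d`, with the Euclidean distance. -/
abbrev Cube (d : ℕ) : Type :=
  {x : EuclideanSpace ℝ (Fin d) // ∀ i, x i ∈ Set.Icc (0 : ℝ) 1}

/-- Lebesgue measure on `[0,1]^d`. -/
noncomputable def lebesgue (d : ℕ) : Measure (Cube d) := Measure.comap Subtype.val volume

/-- Cost vectors: elements of `[0,1]^M`. Labels are the elements of `Fin M`. -/
abbrev Costs (M : ℕ) : Type := Fin M → unitInterval

/-- A probability distribution `P` of `(X, c)` on `[0,1]^d × [0,1]^M`, together with the version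
of the conditional law of `c` given `X = x`, defined for every `x`, from which the costs requested
at the point `x` are drawn. -/
structure CostModel (d M : ℕ) where
  law : Measure (Cube d × Costs M)
  isProbabilityMeasure_law : IsProbabilityMeasure law
  oracle : Kernel (Cube d) (Costs M)
  isMarkovKernel_oracle : IsMarkovKernel oracle
  law_eq : law.fst.compProd oracle = law

namespace CostModel

variable {d M : ℕ}

/-- The marginal `P_X`. -/
noncomputable def marginal (P : CostModel d M) : Measure (Cube d) := P.law.fst

/-- The expected prediction cost `f(x; y) = E(c(y) | X = x)`. -/
noncomputable def meanCost (P : CostModel d M) (x : Cube d) (y : Fin M) : ℝ :=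
  ∫ c, (c y : ℝ) ∂(P.oracle x)

/-- The cost-sensitive risk `R_cs(g) = E c(g(X))`. -/
noncomputable def risk (P : CostModel d M) (g : Cube d → Fin M) : ℝ :=
  ∫ z, (z.2 (g z.1) : ℝ) ∂P.law

theorem exists_minimal_label [M.AtLeastTwo] (P : CostModel d M) (x : Cube d) :
    (Finset.univ.filter fun y => ∀ y', P.meanCost x y ≤ P.meanCost x y').Nonempty := by
  obtain ⟨y, hy⟩ := Finite.exists_min (P.meanCost x)
  exact ⟨y, by simpa using hy⟩

/-- The Bayes classifier: a label of minimal expected cost (the smallest such label). -/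
noncomputable def bayes [M.AtLeastTwo] (P : CostModel d M) (x : Cube d) : Fin M :=
  (Finset.univ.filter fun y => ∀ y', P.meanCost x y ≤ P.meanCost x y').min'
    (P.exists_minimal_label x)

/-- `Δ(x, y) = f(x; y) - min_{y'} f(x; y')`. -/
noncomputable def labelGap (P : CostModel d M) (x : Cube d) (y : Fin M) : ℝ :=
  P.meanCost x y - ⨅ y', P.meanCost x y'

/-- `Δ(x)`: the smallest positive `Δ(x, y)`, and `∞` if there is none. -/
noncomputable def gap (P : CostModel d M) (x : Cube d) : EReal :=
  ⨅ (y : Fin M) (_ : 0 < P.labelGap x y), (P.labelGap x y : EReal)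

/-- The costs `f(x; ·)` in nondecreasing order. -/
noncomputable def sortedCost (P : CostModel d M) (x : Cube d) : Fin M → ℝ :=
  P.meanCost x ∘ Tuple.sort (P.meanCost x)

/-- `Δ'(x)`: second smallest minus smallest expected cost, counted with multiplicity. -/
noncomputable def gap' [hM : M.AtLeastTwo] (P : CostModel d M) (x : Cube d) : ℝ :=
  P.sortedCost x ⟨1, hM.prop⟩ - P.sortedCost x ⟨0, lt_trans Nat.zero_lt_one hM.prop⟩

/-- Hölder smoothness of the expected cost functions. -/
def Smooth (P : CostModel d M) (α L : ℝ) : Prop :=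
  ∀ (y : Fin M) (x z : Cube d), |P.meanCost x y - P.meanCost z y| ≤ L * dist x z ^ α

/-- The refined margin noise assumption. -/
def MarginNoise [M.AtLeastTwo] (P : CostModel d M) (β Cβ Cβ' τ : ℝ) : Prop :=
  ∀ ε : ℝ, 0 < ε →
    P.marginal.real {x | P.gap x ≤ (ε : EReal)} ≤ Cβ * ε ^ β ∧
    P.marginal.real {x | P.gap' x ≤ ε} ≤ τ + Cβ' * ε ^ β

/-- The strong density assumption. -/
def StrongDensity (P : CostModel d M) (μmin μmax : ℝ) : Prop :=
  ∃ p : Cube d → ℝ, Measurable p ∧ (∀ x, 0 ≤ p x) ∧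
    P.marginal = (lebesgue d).withDensity (fun x => ENNReal.ofReal (p x)) ∧
    ∀ x, 0 < p x → μmin ≤ p x ∧ p x ≤ μmax

end CostModel

/-- The parameter `ζ = (α, L, β, C_β, C'_β, τ, μ_min, μ_max)`. -/
structure Params where
  α : ℝ
  L : ℝ
  β : ℝ
  Cβ : ℝ
  Cβ' : ℝ
  τ : ℝ
  μmin : ℝ
  μmax : ℝ

/-- `Ξ = (0,1) × (0,∞)^4 × [0,1] × (0,1) × (0,∞)`. -/
def paramSet : Set Params :=
  {ζ | ζ.α ∈ Set.Ioo (0 : ℝ) 1 ∧ 0 < ζ.L ∧ 0 < ζ.β ∧ 0 < ζ.Cβ ∧ 0 < ζ.Cβ' ∧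
    ζ.τ ∈ Set.Icc (0 : ℝ) 1 ∧ ζ.μmin ∈ Set.Ioo (0 : ℝ) 1 ∧ 0 < ζ.μmax}

/-- The class `P_cs(ζ)` of cost-sensitive classification measures. -/
def measureClass (d M : ℕ) [M.AtLeastTwo] (ζ : Params) : Set (CostModel d M) :=
  {P | P.Smooth ζ.α ζ.L ∧ P.MarginNoise ζ.β ζ.Cβ ζ.Cβ' ζ.τ ∧ P.StrongDensity ζ.μmin ζ.μmax}

/-- A (possibly randomized) active learning algorithm with budget `n`. It first draws a seed: its
internal randomness, whose law may depend on the marginal `P_X`, so that the seed can contain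
unlabelled data. Then, for `t = 0, …, n - 1`, it chooses a query point from the seed and the first
`t` pairs (point, observed cost vector). Finally it returns a classifier that depends on the seed
and the `n` observed pairs. -/
structure ActiveLearner (d M n : ℕ) where
  Seed : Type
  measurableSpaceSeed : MeasurableSpace Seed
  seedLaw : Measure (Cube d) → Measure Seed
  isProbabilityMeasure_seedLaw :
    ∀ μ : Measure (Cube d), IsProbabilityMeasure μ → IsProbabilityMeasure (seedLaw μ)
  query : (t : ℕ) → Seed × (Fin t → Cube d × Costs M) → Cube d
  measurable_query : ∀ t, Measurable (query t)
  classify : (Seed × (Fin n → Cube d × Costs M)) × Cube d → Fin M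
  measurable_classify : Measurable classify

attribute [instance] ActiveLearner.measurableSpaceSeed

namespace ActiveLearner

variable {d M n : ℕ}

/-- The joint law of the seed and of the first `t` pairs `(X_i, c_i)`, when `A` interacts with
`P`: given the past, `X_{t+1}` is the query point and `c_{t+1}` is drawn from the conditional law
of `c` given `X = X_{t+1}`. -/
noncomputable def transcriptLaw (A : ActiveLearner d M n) (P : CostModel d M) :
    (t : ℕ) → Measure (A.Seed × (Fin t → Cube d × Costs M))
  | 0 => (A.seedLaw P.marginal).map fun ω => (ω, fun i => i.elim0)
  | t + 1 =>
    ((A.transcriptLaw P t).compProd (P.oracle.comap (A.query t) (A.measurable_query t))).map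
      fun z => (z.1.1, Fin.snoc (α := fun _ => Cube d × Costs M) z.1.2 (A.query t z.1, z.2))

/-- The expected excess risk `E (R_cs(ĝ_n) - R_cs(f*_cs))` of the classifier returned by `A`. -/
noncomputable def expectedExcessRisk [M.AtLeastTwo] (A : ActiveLearner d M n)
    (P : CostModel d M) : ℝ :=
  ∫ s, (P.risk (fun x => A.classify (s, x)) - P.risk P.bayes) ∂(A.transcriptLaw P n)

end ActiveLearner

end CostSensitive

/-! With two labels a problem is described by its marginal and its margin function `F x = f(x; 0) -
f(x; 1)`. Then `Δ'(x) = |F x|`, whereas `Δ(x) = ∞` where `F` vanishes. The margin condition on `Δ`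
thus ignores the zero set of `F`, and the condition on `Δ'` tolerates one of mass at most `τ`. Hard
problems hide a few informative cells in a large region of zero margin.

Split a cube of side `ρ` at the origin into `q ^ d` cells. Let `F` vanish on it, except for signed
bumps of height of order `q ^ (-α)` in about `q ^ (d - αβ)` of the cells. Each piece has mass of
order `q ^ (-d)`, so the bumps have total mass of order `q ^ (-αβ)`, which is what the condition on
`Δ` allows. The marginal charges a piece in every cell, bump or no bump, so it reveals nothing about
the pattern. Detecting a bump takes about `q ^ (2α)` queries in its cell, and the learner does not
know which cells to look at. With `n` of order `q ^ (2α + d)` it therefore misses a constant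
fraction of the bumps, at a cost of order `q ^ (-α) * q ^ (-αβ) = q ^ (-α(β + 1))`, that is, `n ^
(-α(β + 1) / (2α + d))`.

The information bound is `two_point_lower_bound`: two opposite perturbations `± ψ` are compared
through their likelihood ratios relative to the unperturbed problem, and only queries made under
that problem count. Applied to a pattern with `k` bumps and to each free cell, it is useful because
the `n` queries are shared among all free cells. Double counting (`exists_signPattern_large_sum`)
turns this average over the added bump into one bad pattern with `k + 1` bumps; the result is
`BumpFamily.exists_large_excessRisk`. Membership in the class is `GridSetup.model_mem_measureClass`.

This yields `C * (1 / n) ^ (α(β + 1) / (2α + d))` with `C` depending on `ζ` but not on `n`. As `τ ≤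
1` and `1 / n ≤ 1`, this dominates both terms of the first maximum, hence the minimum in the
theorem. -/

namespace CostSensitive

open scoped ENNReal

variable {d n : ℕ}

/-! ### Two-label problems with a prescribed margin function -/

/-- The cost vector `(1, 0)`: only label `1` is correct. -/
def costZero : Costs 2 := ![1, 0]

/-- The cost vector `(0, 1)`: only label `0` is correct. -/
def costOne : Costs 2 := ![0, 1]

/-- The kernel drawing `(1, 0)` with probability `(1 + F x) / 2` and `(0, 1)` otherwise. -/
noncomputable def binaryOracle (F : Cube d → ℝ) (hF : Measurable F) :
    Kernel (Cube d) (Costs 2) where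
  toFun x := ENNReal.ofReal ((1 + F x) / 2) • Measure.dirac costZero +
    ENNReal.ofReal ((1 - F x) / 2) • Measure.dirac costOne
  measurable' := by
    refine Measure.measurable_of_measurable_coe _ fun s _ => ?_
    simp only [Measure.add_apply, Measure.smul_apply, smul_eq_mul]
    fun_prop

theorem binaryOracle_apply (F : Cube d → ℝ) (hF : Measurable F) (x : Cube d) :
    binaryOracle F hF x = ENNReal.ofReal ((1 + F x) / 2) • Measure.dirac costZero +
      ENNReal.ofReal ((1 - F x) / 2) • Measure.dirac costOne := rfl

theorem isMarkovKernel_binaryOracle (F : Cube d → ℝ) (hF : Measurable F)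
    (hF1 : ∀ x, |F x| ≤ 1) : IsMarkovKernel (binaryOracle F hF) := by
  refine ⟨fun x => ⟨?_⟩⟩
  have h := abs_le.1 (hF1 x)
  simp only [binaryOracle_apply, Measure.add_apply, Measure.smul_apply, measure_univ, smul_eq_mul,
    mul_one]
  rw [← ENNReal.ofReal_add (by linarith) (by linarith)]
  ring_nf
  simp

theorem lintegral_binaryOracle (F : Cube d → ℝ) (hF : Measurable F) (x : Cube d)
    (g : Costs 2 → ℝ≥0∞) :
    ∫⁻ c, g c ∂(binaryOracle F hF x) =
      ENNReal.ofReal ((1 + F x) / 2) * g costZero +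
        ENNReal.ofReal ((1 - F x) / 2) * g costOne := by
  rw [binaryOracle_apply, lintegral_add_measure, lintegral_smul_measure, lintegral_smul_measure]
  simp

theorem integral_binaryOracle (F : Cube d → ℝ) (hF : Measurable F) (hF1 : ∀ x, |F x| ≤ 1)
    (x : Cube d) (g : Costs 2 → ℝ) :
    ∫ c, g c ∂(binaryOracle F hF x) =
      (1 + F x) / 2 * g costZero + (1 - F x) / 2 * g costOne := by
  have h := abs_le.1 (hF1 x)
  have hi : ∀ c : Costs 2, Integrable g (Measure.dirac c) := fun c =>
    integrable_dirac (by finiteness)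
  rw [binaryOracle_apply, integral_add_measure ((hi _).smul_measure (by finiteness))
    ((hi _).smul_measure (by finiteness)), integral_smul_measure, integral_smul_measure]
  simp only [integral_dirac, smul_eq_mul]
  rw [ENNReal.toReal_ofReal (by linarith), ENNReal.toReal_ofReal (by linarith)]

/-- The two-label problem with marginal `μ` and `f(x; 0) - f(x; 1) = F x`. -/
noncomputable def binaryModel (μ : Measure (Cube d)) (hμ : IsProbabilityMeasure μ)
    (F : Cube d → ℝ) (hF : Measurable F) (hF1 : ∀ x, |F x| ≤ 1) : CostModel d 2 :=
  haveI := isMarkovKernel_binaryOracle F hF hF1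
  { law := μ.compProd (binaryOracle F hF)
    isProbabilityMeasure_law := inferInstance
    oracle := binaryOracle F hF
    isMarkovKernel_oracle := inferInstance
    law_eq := by rw [Measure.fst_compProd] }

theorem marginal_binaryModel (μ : Measure (Cube d)) (hμ : IsProbabilityMeasure μ)
    (F : Cube d → ℝ) (hF : Measurable F) (hF1 : ∀ x, |F x| ≤ 1) :
    (binaryModel μ hμ F hF hF1).marginal = μ := by
  have := isMarkovKernel_binaryOracle F hF hF1
  exact Measure.fst_compProd _ _

theorem oracle_binaryModel : (binaryModel μ hμ F hF hF1).oracle = binaryOracle F hF := rfl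

theorem meanCost_binaryModel (μ : Measure (Cube d)) (hμ : IsProbabilityMeasure μ)
    (F : Cube d → ℝ) (hF : Measurable F) (hF1 : ∀ x, |F x| ≤ 1)
    (x : Cube d) (y : Fin 2) :
    (binaryModel μ hμ F hF hF1).meanCost x y = (1 + if y = 0 then F x else - F x) / 2 := by
  unfold CostModel.meanCost
  rw [oracle_binaryModel, integral_binaryOracle F hF hF1]
  fin_cases y <;> simp [costZero, costOne]
  ring

theorem bayes_binaryModel (μ : Measure (Cube d)) (hμ : IsProbabilityMeasure μ)
    (F : Cube d → ℝ) (hF : Measurable F) (hF1 : ∀ x, |F x| ≤ 1)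
    (x : Cube d) :
    (binaryModel μ hμ F hF hF1).bayes x = if F x ≤ 0 then 0 else 1 := by
  unfold CostModel.bayes
  rw [Finset.min'_eq_iff]
  have h10 : (1 : Fin 2) ≠ 0 := by decide
  simp only [meanCost_binaryModel, Finset.mem_filter, Finset.mem_univ, true_and,
    Fin.forall_fin_two, if_true, if_neg h10]
  rcases le_or_gt (F x) 0 with h | h
  · simp only [if_pos h, if_true]
    exact ⟨⟨le_refl _, by linarith⟩, fun _ => le_refl _, fun _ => Fin.zero_le _⟩
  · simp only [if_neg (not_le.2 h), if_neg h10]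
    exact ⟨⟨by linarith, le_refl _⟩, fun h' => absurd h'.2 (by linarith), fun _ => le_refl _⟩

theorem risk_binaryModel (μ : Measure (Cube d)) (hμ : IsProbabilityMeasure μ)
    (F : Cube d → ℝ) (hF : Measurable F) (hF1 : ∀ x, |F x| ≤ 1)
    (g : Cube d → Fin 2) (hg : Measurable g) :
    (binaryModel μ hμ F hF hF1).risk g = ∫ x, (1 + if g x = 0 then F x else - F x) / 2 ∂μ := by
  have := isMarkovKernel_binaryOracle F hF hF1
  have hm : Measurable fun z : Cube d × Costs 2 => ((z.2 (g z.1) : unitInterval) : ℝ) := by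
    have h1 : ∀ y : Fin 2, Measurable fun z : Cube d × Costs 2 => ((z.2 y : unitInterval) : ℝ) :=
      fun y => measurable_subtype_coe.comp ((measurable_pi_apply y).comp measurable_snd)
    have : (fun z : Cube d × Costs 2 => ((z.2 (g z.1) : unitInterval) : ℝ)) =
        fun z => if g z.1 = 0 then ((z.2 0 : unitInterval) : ℝ) else (z.2 1 : unitInterval) := by
      funext z
      split_ifs with h
      · rw [h]
      · rw [Fin.eq_one_of_ne_zero _ h]
    rw [this]
    exact Measurable.ite ((hg.comp measurable_fst) (measurableSet_singleton 0)) (h1 0) (h1 1)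
  unfold CostModel.risk
  change ∫ z, _ ∂(μ.compProd (binaryOracle F hF)) = _
  rw [Measure.integral_compProd]
  · refine integral_congr_ae (.of_forall fun x => ?_)
    exact meanCost_binaryModel μ hμ F hF hF1 x (g x)
  · refine Integrable.of_bound hm.aestronglyMeasurable 1 (.of_forall fun z => ?_)
    rw [Real.norm_eq_abs, abs_of_nonneg (z.2 _).2.1]
    exact (z.2 _).2.2

/-- The regret of the label `y` at `x`. -/
noncomputable def regret (F : Cube d → ℝ) (x : Cube d) (y : Fin 2) : ℝ :=
  ((if y = 0 then F x else - F x) + |F x|) / 2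

theorem regret_nonneg (F : Cube d → ℝ) (x : Cube d) (y : Fin 2) : 0 ≤ regret F x y := by
  unfold regret
  split_ifs
  · linarith [neg_abs_le (F x)]
  · linarith [le_abs_self (F x)]

theorem regret_le_one (F : Cube d → ℝ) (hF1 : ∀ x, |F x| ≤ 1) (x : Cube d) (y : Fin 2) : regret F x y ≤ 1 := by
  have := abs_le.1 (hF1 x)
  have := hF1 x
  unfold regret
  split_ifs <;> linarith

theorem measurable_regret (F : Cube d → ℝ) (hF : Measurable F)
    {Ω : Type*} [MeasurableSpace Ω] {u : Ω → Cube d} (hu : Measurable u)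
    {g : Ω → Fin 2} (hg : Measurable g) : Measurable fun ω => regret F (u ω) (g ω) := by
  have hF' := hF.comp hu
  exact ((Measurable.ite (hg (measurableSet_singleton 0)) hF' hF'.neg).add
    (continuous_abs.measurable.comp hF')).div_const 2

theorem excessRisk_binaryModel (μ : Measure (Cube d)) (hμ : IsProbabilityMeasure μ)
    (F : Cube d → ℝ) (hF : Measurable F) (hF1 : ∀ x, |F x| ≤ 1)
    (g : Cube d → Fin 2) (hg : Measurable g) :
    (binaryModel μ hμ F hF hF1).risk g -
      (binaryModel μ hμ F hF hF1).risk (binaryModel μ hμ F hF hF1).bayes =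
      ∫ x, regret F x (g x) ∂μ := by
  have hb : (binaryModel μ hμ F hF hF1).bayes = fun x => if F x ≤ 0 then 0 else 1 :=
    funext (bayes_binaryModel μ hμ F hF hF1)
  have hbm : Measurable fun x : Cube d => if F x ≤ 0 then (0 : Fin 2) else 1 :=
    Measurable.ite (measurableSet_le hF measurable_const) measurable_const measurable_const
  have key : ∀ u : Cube d → Fin 2, Measurable u →
      Integrable (fun x => (1 + if u x = 0 then F x else - F x) / 2) μ := by
    intro u hu
    refine Integrable.of_bound (C := 1) ?_ (.of_forall fun x => ?_)
    · exact ((measurable_const.add (Measurable.ite (hu (measurableSet_singleton 0))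
        hF hF.neg)).div_const 2).aestronglyMeasurable
    · have := abs_le.1 (hF1 x)
      rw [Real.norm_eq_abs, abs_le]
      split_ifs <;> constructor <;> linarith
  rw [hb, risk_binaryModel _ _ _ _ _ _ hg, risk_binaryModel _ _ _ _ _ _ hbm,
    ← integral_sub (key _ hg) (key _ hbm)]
  refine integral_congr_ae (.of_forall fun x => ?_)
  simp only [regret]
  rcases le_or_gt (F x) 0 with h | h
  · simp only [h, if_true, abs_of_nonpos h]
    ring
  · simp only [not_le.2 h, if_false, abs_of_pos h]
    simp
    ring

/-! ### Law of the transcript and change of measure -/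

theorem measurable_appendStep {M : ℕ} (A : ActiveLearner d M n) (t : ℕ) :
    Measurable fun z : (A.Seed × (Fin t → Cube d × Costs M)) × Costs M =>
      ((z.1.1, Fin.snoc (α := fun _ => Cube d × Costs M) z.1.2 (A.query t z.1, z.2)) :
        A.Seed × (Fin (t + 1) → Cube d × Costs M)) := by
  refine (measurable_fst.comp measurable_fst).prodMk (measurable_pi_lambda _ fun i => ?_)
  refine Fin.lastCases ?_ (fun i => ?_) i
  · simp only [Fin.snoc_last]
    exact ((A.measurable_query t).comp measurable_fst).prodMk measurable_snd
  · simp only [Fin.snoc_castSucc]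
    exact (measurable_pi_apply i).comp (measurable_snd.comp measurable_fst)

theorem isProbabilityMeasure_transcriptLaw {M : ℕ} (A : ActiveLearner d M n) (P : CostModel d M)
    (t : ℕ) : IsProbabilityMeasure (A.transcriptLaw P t) := by
  have := P.isProbabilityMeasure_law
  have := P.isMarkovKernel_oracle
  induction t with
  | zero =>
    have := A.isProbabilityMeasure_seedLaw P.marginal
      (by unfold CostModel.marginal; infer_instance)
    unfold ActiveLearner.transcriptLaw
    exact Measure.isProbabilityMeasure_map (by fun_prop)
  | succ t ih =>
    unfold ActiveLearner.transcriptLaw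
    exact Measure.isProbabilityMeasure_map (measurable_appendStep A t).aemeasurable

theorem lintegral_transcriptLaw_succ {M : ℕ} (A : ActiveLearner d M n) (P : CostModel d M) (t : ℕ)
    (g : A.Seed × (Fin (t + 1) → Cube d × Costs M) → ℝ≥0∞) (hg : Measurable g) :
    ∫⁻ s, g s ∂(A.transcriptLaw P (t + 1)) =
      ∫⁻ s, ∫⁻ c, g (s.1, Fin.snoc (α := fun _ => Cube d × Costs M) s.2 (A.query t s, c))
        ∂(P.oracle (A.query t s)) ∂(A.transcriptLaw P t) := by
  have := P.isMarkovKernel_oracle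
  have := isProbabilityMeasure_transcriptLaw A P t
  conv_lhs => unfold ActiveLearner.transcriptLaw
  rw [lintegral_map hg (measurable_appendStep A t), Measure.lintegral_compProd]
  · rfl
  · exact hg.comp (measurable_appendStep A t)

/-- If the oracle of `Q` has density `ℓ` with respect to the oracle of `P`, then the law of the
transcript under `Q` has the product of the `ℓ`'s as density with respect to that under `P`. -/
theorem lintegral_transcriptLaw_of_density {M : ℕ} (A : ActiveLearner d M n)
    (P Q : CostModel d M) (hPQ : P.marginal = Q.marginal) (ℓ : Cube d × Costs M → ℝ≥0∞)
    (hℓ : Measurable ℓ)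
    (h : ∀ x (g : Costs M → ℝ≥0∞), Measurable g →
      ∫⁻ c, g c ∂(Q.oracle x) = ∫⁻ c, ℓ (x, c) * g c ∂(P.oracle x))
    (t : ℕ) (g : A.Seed × (Fin t → Cube d × Costs M) → ℝ≥0∞) (hg : Measurable g) :
    ∫⁻ s, g s ∂(A.transcriptLaw Q t) =
      ∫⁻ s, (∏ u, ℓ (s.2 u)) * g s ∂(A.transcriptLaw P t) := by
  have hprod : ∀ t, Measurable fun s : A.Seed × (Fin t → Cube d × Costs M) =>
      ∏ u, ℓ (s.2 u) := fun t => Finset.measurable_prod _ fun u _ =>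
    hℓ.comp ((measurable_pi_apply u).comp measurable_snd)
  induction t with
  -- The seed law depends on the problem only through the marginal, so the seed contributes no
  -- factor.
  | zero => simp [ActiveLearner.transcriptLaw, hPQ]
  | succ t ih =>
    have := Q.isMarkovKernel_oracle
    rw [lintegral_transcriptLaw_succ A Q t g hg,
      lintegral_transcriptLaw_succ A P t (fun s => (∏ u, ℓ (s.2 u)) * g s) ((hprod _).mul hg), ih]
    · refine lintegral_congr fun s => ?_
      have hm : Measurable fun c : Costs M =>
          g (s.1, Fin.snoc (α := fun _ => Cube d × Costs M) s.2 (A.query t s, c)) :=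
        hg.comp ((measurable_appendStep A t).comp measurable_prodMk_left)
      rw [h _ _ hm, ← lintegral_const_mul]
      · refine lintegral_congr fun c => ?_
        simp only [Fin.prod_univ_castSucc, Fin.snoc_castSucc, Fin.snoc_last]
        ring
      · exact (hℓ.comp measurable_prodMk_left).mul hm
    · exact (Measurable.lintegral_kernel_prod_right' (κ := Q.oracle.comap (A.query t)
        (A.measurable_query t)) (hg.comp (measurable_appendStep A t)))

theorem transcriptLaw_eq_withDensity {M : ℕ} (A : ActiveLearner d M n)
    (P Q : CostModel d M) (hPQ : P.marginal = Q.marginal) (ℓ : Cube d × Costs M → ℝ≥0∞)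
    (hℓ : Measurable ℓ)
    (h : ∀ x (g : Costs M → ℝ≥0∞), Measurable g →
      ∫⁻ c, g c ∂(Q.oracle x) = ∫⁻ c, ℓ (x, c) * g c ∂(P.oracle x)) (t : ℕ) :
    A.transcriptLaw Q t = (A.transcriptLaw P t).withDensity fun s => ∏ u, ℓ (s.2 u) := by
  ext s hs
  rw [withDensity_apply _ hs, ← lintegral_indicator hs, ← lintegral_indicator_one hs,
    lintegral_transcriptLaw_of_density A P Q hPQ ℓ hℓ h t _ (measurable_one.indicator hs)]
  refine lintegral_congr fun z => ?_
  by_cases hz : z ∈ s <;> simp [hz]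

/-! ### Likelihood ratios and the two-point bound -/

/-- The sign carried by a cost vector of a `binaryModel`: `1` at `(1, 0)` and `-1` at `(0, 1)`. -/
noncomputable def signal (c : Costs 2) : ℝ := 2 * (c 0 : ℝ) - 1

theorem measurable_signal : Measurable signal :=
  (measurable_const.mul (measurable_subtype_coe.comp (measurable_pi_apply 0))).sub_const 1

theorem abs_signal_le_one (c : Costs 2) : |signal c| ≤ 1 := by
  have h := (c 0).2
  unfold signal
  rw [abs_le]
  constructor <;> linarith [h.1, h.2]

/-- The likelihood ratio of a transcript when the margin function is perturbed by `ψ`. -/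
noncomputable def likelihood {t : ℕ} (ψ : Cube d → ℝ) (h : Fin t → Cube d × Costs 2) : ℝ :=
  ∏ u, (1 + ψ (h u).1 * signal (h u).2)

theorem abs_mul_signal_le_one {ψ : Cube d → ℝ} (hψ1 : ∀ x, |ψ x| ≤ 1) (x : Cube d)
    (c : Costs 2) : |ψ x * signal c| ≤ 1 := by
  rw [abs_mul]
  exact mul_le_one₀ (hψ1 x) (abs_nonneg _) (abs_signal_le_one c)

theorem likelihood_nonneg {t : ℕ} {ψ : Cube d → ℝ} (hψ1 : ∀ x, |ψ x| ≤ 1)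
    (h : Fin t → Cube d × Costs 2) : 0 ≤ likelihood ψ h :=
  Finset.prod_nonneg fun u _ => by
    linarith [(abs_le.1 (abs_mul_signal_le_one hψ1 (h u).1 (h u).2)).1]

theorem likelihood_le {t : ℕ} {ψ : Cube d → ℝ} (hψ1 : ∀ x, |ψ x| ≤ 1)
    (h : Fin t → Cube d × Costs 2) : likelihood ψ h ≤ 2 ^ t := by
  have : likelihood ψ h ≤ ∏ _u : Fin t, (2 : ℝ) :=
    Finset.prod_le_prod
      (fun u _ => by linarith [(abs_le.1 (abs_mul_signal_le_one hψ1 (h u).1 (h u).2)).1])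
      (fun u _ => by linarith [(abs_le.1 (abs_mul_signal_le_one hψ1 (h u).1 (h u).2)).2])
  simpa using this

theorem measurable_likelihood {t : ℕ} {Ω : Type*} [MeasurableSpace Ω] {ψ : Cube d → ℝ}
    (hψ : Measurable ψ) :
    Measurable fun s : Ω × (Fin t → Cube d × Costs 2) => likelihood ψ s.2 := by
  refine Finset.measurable_prod _ fun u _ => ?_
  have hu : Measurable fun s : Ω × (Fin t → Cube d × Costs 2) => s.2 u :=
    (measurable_pi_apply u).comp measurable_snd
  exact measurable_const.add ((hψ.comp (measurable_fst.comp hu)).mul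
    (measurable_signal.comp (measurable_snd.comp hu)))

theorem one_sub_sum_le_prod_one_sub {ι : Type*} (s : Finset ι) (a : ι → ℝ)
    (h0 : ∀ i, 0 ≤ a i) (h1 : ∀ i, a i ≤ 1) :
    1 - ∑ i ∈ s, a i ≤ ∏ i ∈ s, (1 - a i) := by
  classical
  induction s using Finset.induction_on with
  | empty => simp
  | insert i s hi ih =>
    rw [Finset.sum_insert hi, Finset.prod_insert hi]
    have h2 : 0 ≤ ∑ j ∈ s, a j := Finset.sum_nonneg fun j _ => h0 j
    have h3 : ∏ j ∈ s, (1 - a j) ≤ 1 :=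
      Finset.prod_le_one (fun j _ => by linarith [h1 j]) fun j _ => by linarith [h0 j]
    nlinarith [h0 i, h1 i]

/-- Opposite factors multiply to `1 - (ψ * signal) ^ 2`, so the terms linear in the signal cancel
and only the energy `∑ ψ ^ 2` of the queried points remains. -/
theorem likelihood_mul_likelihood_neg {t : ℕ} {ψ : Cube d → ℝ} (hψ1 : ∀ x, |ψ x| ≤ 1)
    (h : Fin t → Cube d × Costs 2) :
    1 - ∑ u, ψ (h u).1 ^ 2 ≤ likelihood ψ h * likelihood (fun x => - ψ x) h ∧
      likelihood ψ h * likelihood (fun x => - ψ x) h ≤ 1 := by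
  have e : likelihood ψ h * likelihood (fun x => - ψ x) h =
      ∏ u, (1 - (ψ (h u).1 * signal (h u).2) ^ 2) := by
    unfold likelihood
    rw [← Finset.prod_mul_distrib]
    exact Finset.prod_congr rfl fun u _ => by ring
  have hs : ∀ u, (ψ (h u).1 * signal (h u).2) ^ 2 ≤ 1 := fun u =>
    (sq_le_one_iff_abs_le_one _).2 (abs_mul_signal_le_one hψ1 _ _)
  rw [e]
  constructor
  · refine le_trans ?_ (one_sub_sum_le_prod_one_sub _ _ (fun u => sq_nonneg _) hs)
    refine sub_le_sub_left (Finset.sum_le_sum fun u _ => ?_) _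
    rw [mul_pow]
    exact mul_le_of_le_one_right (sq_nonneg _)
      ((sq_le_one_iff_abs_le_one _).2 (abs_signal_le_one _))
  · exact Finset.prod_le_one (fun u _ => by linarith [hs u]) fun u _ => by
      linarith [sq_nonneg (ψ (h u).1 * signal (h u).2)]

/-- Since `F * ψ = 0`, one has `(1 ± F) * (1 ± ψ) = 1 ± (F + ψ)` with equal signs. The density of
one answer is therefore `1 + ψ * signal`, with no division by `1 ± F`. -/
theorem transcriptLaw_perturb (A : ActiveLearner d 2 n) (μ : Measure (Cube d))
    (hμ : IsProbabilityMeasure μ) (F F' ψ : Cube d → ℝ) (hF : Measurable F) (hF1 : ∀ x, |F x| ≤ 1)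
    (hF' : Measurable F') (hF1' : ∀ x, |F' x| ≤ 1) (hψ : Measurable ψ) (hψ1 : ∀ x, |ψ x| ≤ 1)
    (hadd : ∀ x, F' x = F x + ψ x) (hmul : ∀ x, F x * ψ x = 0) (t : ℕ) :
    A.transcriptLaw (binaryModel μ hμ F' hF' hF1') t =
      (A.transcriptLaw (binaryModel μ hμ F hF hF1) t).withDensity fun s =>
        ENNReal.ofReal (likelihood ψ s.2) := by
  rw [transcriptLaw_eq_withDensity A (binaryModel μ hμ F hF hF1) (binaryModel μ hμ F' hF' hF1')
    (by rw [marginal_binaryModel, marginal_binaryModel])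
    (fun z => ENNReal.ofReal (1 + ψ z.1 * signal z.2))]
  · congr 1
    funext s
    unfold likelihood
    rw [ENNReal.ofReal_prod_of_nonneg]
    intro u _
    linarith [(abs_le.1 (abs_mul_signal_le_one hψ1 (s.2 u).1 (s.2 u).2)).1]
  · exact (measurable_const.add ((hψ.comp measurable_fst).mul
      (measurable_signal.comp measurable_snd))).ennreal_ofReal
  · intro x g _
    have h0 : signal costZero = 1 := by simp [signal, costZero]; norm_num
    have h1 : signal costOne = -1 := by simp [signal, costOne]
    have ha := abs_le.1 (hF1 x)
    have hb := abs_le.1 (hψ1 x)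
    rw [oracle_binaryModel, oracle_binaryModel, lintegral_binaryOracle, lintegral_binaryOracle,
      h0, h1, ← mul_assoc, ← mul_assoc, ← ENNReal.ofReal_mul (by linarith),
      ← ENNReal.ofReal_mul (by linarith), hadd]
    congr 3
    · linear_combination (-1 / 2) * hmul x
    · linear_combination (-1 / 2) * hmul x

theorem integral_transcriptLaw_perturb (A : ActiveLearner d 2 n) (μ : Measure (Cube d))
    (hμ : IsProbabilityMeasure μ) (F F' ψ : Cube d → ℝ) (hF : Measurable F) (hF1 : ∀ x, |F x| ≤ 1)
    (hF' : Measurable F') (hF1' : ∀ x, |F' x| ≤ 1) (hψ : Measurable ψ) (hψ1 : ∀ x, |ψ x| ≤ 1)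
    (hadd : ∀ x, F' x = F x + ψ x) (hmul : ∀ x, F x * ψ x = 0) (t : ℕ)
    (g : A.Seed × (Fin t → Cube d × Costs 2) → ℝ) :
    ∫ s, g s ∂(A.transcriptLaw (binaryModel μ hμ F' hF' hF1') t) =
      ∫ s, likelihood ψ s.2 * g s ∂(A.transcriptLaw (binaryModel μ hμ F hF hF1) t) := by
  rw [transcriptLaw_perturb A μ hμ F F' ψ hF hF1 hF' hF1' hψ hψ1 hadd hmul,
    integral_withDensity_eq_integral_toReal_smul (measurable_likelihood hψ).ennreal_ofReal
      (.of_forall fun _ => ENNReal.ofReal_lt_top)]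
  refine integral_congr_ae (.of_forall fun s => ?_)
  simp only [smul_eq_mul, ENNReal.toReal_ofReal (likelihood_nonneg hψ1 s.2)]

/-- For `a * b ≤ 1`, the mean inequality gives `8ab ≤ 8√(ab) ≤ 16a + b`, hence `ab / 2 - (a + b) /
16 ≤ a`, and symmetrically for `b`. This lower bound for `min a b` is affine in `a`, `b` and `ab`,
so it can be integrated without square roots. -/
theorem affinity_le_mixture {a b q w x y : ℝ} (ha : 0 ≤ a) (hb : 0 ≤ b) (hab : a * b ≤ 1)
    (hq : q ≤ a * b) (hx : 0 ≤ x) (hy : 0 ≤ y) (hw : x + y = w) :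
    w * (q / 2 - (a + b) / 16) ≤ a * x + b * y := by
  have key : ∀ a b : ℝ, 0 ≤ a → 0 ≤ b → a * b ≤ 1 → a * b / 2 - (a + b) / 16 ≤ a := by
    intro a b ha hb hab
    have : 8 * (a * b) ≤ 16 * a + b := by
      refine le_of_sq_le_sq ?_ (by positivity)
      nlinarith [sq_nonneg (16 * a - b), mul_nonneg ha hb]
    linarith
  have h1 := key a b ha hb hab
  have h2 := key b a hb ha (by linarith [mul_comm a b])
  have h1' : q / 2 - (a + b) / 16 ≤ a := by linarith
  have h2' : q / 2 - (a + b) / 16 ≤ b := by linarith [mul_comm a b]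
  subst hw
  nlinarith

/-- Two opposite perturbations `± ψ` of the margin function cannot be told apart by a learner
which, without perturbation, rarely queries points where `ψ` is nonzero. -/
theorem two_point_lower_bound (A : ActiveLearner d 2 n) (μ : Measure (Cube d))
    (hμ : IsProbabilityMeasure μ) (F F₁ F₂ ψ : Cube d → ℝ)
    (hF : Measurable F) (hF1 : ∀ x, |F x| ≤ 1)
    (hF₁ : Measurable F₁) (hF₁1 : ∀ x, |F₁ x| ≤ 1) (hF₂ : Measurable F₂) (hF₂1 : ∀ x, |F₂ x| ≤ 1)
    (hψ : Measurable ψ) (hψ1 : ∀ x, |ψ x| ≤ 1)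
    (hadd : ∀ x, F₁ x = F x + ψ x) (hsub : ∀ x, F₂ x = F x - ψ x) (hmul : ∀ x, F x * ψ x = 0)
    (t : ℕ) (W₁ W₂ : A.Seed × (Fin t → Cube d × Costs 2) → ℝ) (w : ℝ)
    (hW₁ : Measurable W₁) (hW₂ : Measurable W₂) (h₁ : ∀ s, 0 ≤ W₁ s) (h₂ : ∀ s, 0 ≤ W₂ s)
    (hW : ∀ s, W₁ s + W₂ s = w) :
    w * (3 / 8 - (∫ s, ∑ u, ψ (s.2 u).1 ^ 2
        ∂(A.transcriptLaw (binaryModel μ hμ F hF hF1) t)) / 2) ≤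
      (∫ s, W₁ s ∂(A.transcriptLaw (binaryModel μ hμ F₁ hF₁ hF₁1) t)) +
        ∫ s, W₂ s ∂(A.transcriptLaw (binaryModel μ hμ F₂ hF₂ hF₂1) t) := by
  have hψ' : Measurable fun x => - ψ x := hψ.neg
  have hψ1' : ∀ x, |(fun x => - ψ x) x| ≤ 1 := fun x => by simpa using hψ1 x
  have e₁ := fun g => integral_transcriptLaw_perturb A μ hμ F F₁ ψ hF hF1 hF₁ hF₁1 hψ hψ1 hadd hmul
    t g
  have e₂ := fun g => integral_transcriptLaw_perturb A μ hμ F F₂ (fun x => - ψ x) hF hF1 hF₂ hF₂1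
    hψ' hψ1' (fun x => by rw [hsub]; ring) (fun x => by simp [hmul x]) t g
  have p₁ := isProbabilityMeasure_transcriptLaw A (binaryModel μ hμ F₁ hF₁ hF₁1) t
  have p₂ := isProbabilityMeasure_transcriptLaw A (binaryModel μ hμ F₂ hF₂ hF₂1) t
  have p := isProbabilityMeasure_transcriptLaw A (binaryModel μ hμ F hF hF1) t
  have n₁ := e₁ fun _ => 1
  have n₂ := e₂ fun _ => 1
  rw [e₁, e₂]
  set T := A.transcriptLaw (binaryModel μ hμ F hF hF1) t
  simp only [integral_const, probReal_univ, smul_eq_mul, mul_one] at n₁ n₂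
  have bdd : ∀ {φ : Cube d → ℝ}, Measurable φ → (∀ x, |φ x| ≤ 1) →
      ∀ {W : A.Seed × (Fin t → Cube d × Costs 2) → ℝ}, Measurable W → (∀ s, 0 ≤ W s) →
      ∀ B, (∀ s, W s ≤ B) → Integrable (fun s => likelihood φ s.2 * W s) T := by
    intro φ hφ hφ1 W hWm hW0 B hWB
    refine Integrable.of_bound (C := 2 ^ t * B)
      ((measurable_likelihood hφ).mul hWm).aestronglyMeasurable (.of_forall fun s => ?_)
    rw [Real.norm_eq_abs, abs_of_nonneg (mul_nonneg (likelihood_nonneg hφ1 _) (hW0 s))]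
    exact mul_le_mul (likelihood_le hφ1 _) (hWB s) (hW0 s) (by positivity)
  have i₁ := bdd hψ hψ1 hW₁ h₁ w fun s => by linarith [hW s, h₂ s]
  have i₂ := bdd hψ' hψ1' hW₂ h₂ w fun s => by linarith [hW s, h₁ s]
  have j₁ := bdd hψ hψ1 (W := fun _ => 1) measurable_const (fun _ => zero_le_one) 1
    fun _ => le_refl _
  have j₂ := bdd hψ' hψ1' (W := fun _ => 1) measurable_const (fun _ => zero_le_one) 1
    fun _ => le_refl _
  simp only [mul_one] at j₁ j₂
  have js : Integrable (fun s : A.Seed × (Fin t → Cube d × Costs 2) => ∑ u, ψ (s.2 u).1 ^ 2) T := by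
    refine integrable_finsetSum _ fun u _ => Integrable.of_bound (C := 1)
      ((hψ.comp (measurable_fst.comp ((measurable_pi_apply u).comp measurable_snd))).pow_const
        2).aestronglyMeasurable (.of_forall fun s => ?_)
    rw [Real.norm_eq_abs, abs_of_nonneg (sq_nonneg _)]
    exact (sq_le_one_iff_abs_le_one _).2 (hψ1 _)
  rw [← integral_add i₁ i₂]
  -- Both likelihoods have mean `1`, so the constant is `1 / 2 - 2 / 16 = 3 / 8`.
  have : w * (3 / 8 - (∫ s, ∑ u, ψ (s.2 u).1 ^ 2 ∂T) / 2) =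
      ∫ s, w * ((1 - ∑ u, ψ (s.2 u).1 ^ 2) / 2 -
        (likelihood ψ s.2 + likelihood (fun x => - ψ x) s.2) / 16) ∂T := by
    rw [integral_const_mul, integral_sub, integral_div, integral_div, integral_sub, integral_add,
      ← n₁, ← n₂]
    · simp
      left; ring
    · exact j₁
    · exact j₂
    · exact integrable_const _
    · exact js
    · exact ((integrable_const _).sub js).div_const 2
    · exact (j₁.add j₂).div_const 16
  rw [this]
  refine integral_mono ((((integrable_const _).sub js).div_const 2).sub
    ((j₁.add j₂).div_const 16) |>.const_mul w) (i₁.add i₂) fun s => ?_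
  have hl := likelihood_mul_likelihood_neg hψ1 s.2
  exact affinity_le_mixture (likelihood_nonneg hψ1 _) (likelihood_nonneg hψ1' _) hl.2 hl.1
    (h₁ s) (h₂ s) (hW s)

/-! ### Sign patterns and double counting -/

/-- The indices at which a sign pattern does not vanish. -/
def signSupport {ι : Type*} [Fintype ι] (σ : ι → SignType) : Finset ι :=
  Finset.univ.filter fun i => σ i ≠ 0

theorem mem_signSupport {ι : Type*} [Fintype ι] (σ : ι → SignType) (i : ι) :
    i ∈ signSupport σ ↔ σ i ≠ 0 := by simp [signSupport]

theorem signSupport_update {ι : Type*} [Fintype ι] [DecidableEq ι] (σ : ι → SignType) (i : ι)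
    (hi : σ i = 0) (s : SignType) (hs : s ≠ 0) :
    signSupport (Function.update σ i s) = insert i (signSupport σ) := by
  ext j
  rw [mem_signSupport, Finset.mem_insert, mem_signSupport]
  by_cases hj : j = i
  · subst hj
    simp [hs]
  · simp [hj]

theorem card_signSupport_update {ι : Type*} [Fintype ι] [DecidableEq ι] (σ : ι → SignType) (i : ι)
    (hi : σ i = 0) (s : SignType) (hs : s ≠ 0) :
    (signSupport (Function.update σ i s)).card = (signSupport σ).card + 1 := by
  rw [signSupport_update σ i hi s hs, Finset.card_insert_of_notMem]
  simp [mem_signSupport, hi]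

/-- The sign patterns with exactly `k` nonzero entries. -/
def signPatterns (ι : Type*) [Fintype ι] [DecidableEq ι] (k : ℕ) : Finset (ι → SignType) :=
  Finset.univ.filter fun σ => (signSupport σ).card = k

theorem mem_signPatterns {ι : Type*} [Fintype ι] [DecidableEq ι] {k : ℕ} {σ : ι → SignType} :
    σ ∈ signPatterns ι k ↔ (signSupport σ).card = k := by simp [signPatterns]

theorem signPatterns_nonempty (ι : Type*) [Fintype ι] [DecidableEq ι] {k : ℕ}
    (hk : k ≤ Fintype.card ι) : (signPatterns ι k).Nonempty := by
  obtain ⟨s, -, hs⟩ := Finset.exists_subset_card_eq (s := (Finset.univ : Finset ι)) hk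
  refine ⟨fun i => if i ∈ s then 1 else 0, mem_signPatterns.2 ?_⟩
  rw [← hs]
  congr 1
  ext i
  simp [mem_signSupport]

/-- Removing one nonzero entry from a sign pattern with `k + 1` nonzero entries. -/
theorem sum_signPatterns_succ {ι : Type*} [Fintype ι] [DecidableEq ι] (k : ℕ)
    (a : (ι → SignType) → ι → ℝ) :
    ∑ σ ∈ signPatterns ι (k + 1), ∑ i ∈ signSupport σ, a σ i =
      ∑ σ ∈ signPatterns ι k, ∑ i ∈ (signSupport σ)ᶜ,
        (a (Function.update σ i 1) i + a (Function.update σ i (-1)) i) := by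
  rw [Finset.sum_sigma', Finset.sum_sigma']
  have h1 : (1 : SignType) ≠ 0 := by decide
  have hn1 : (-1 : SignType) ≠ 0 := by decide
  have hR : ∀ z : (_ : ι → SignType) × ι,
      a (Function.update z.1 z.2 1) z.2 + a (Function.update z.1 z.2 (-1)) z.2 =
        ∑ s ∈ ({1, -1} : Finset SignType), a (Function.update z.1 z.2 s) z.2 := fun z => by
    rw [Finset.sum_pair (by decide)]
  simp only [hR]
  rw [← Finset.sum_product']
  symm
  -- A pattern with a marked nonzero entry corresponds to the pattern with that entry erased, the
  -- erased place, and its sign.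
  refine Finset.sum_nbij' (fun z => ⟨Function.update z.1.1 z.1.2 z.2, z.1.2⟩)
    (fun z => (⟨Function.update z.1 z.2 0, z.2⟩, z.1 z.2)) ?_ ?_ ?_ ?_ ?_
  · rintro ⟨⟨σ, i⟩, s⟩ h
    simp only [Finset.mem_product, Finset.mem_sigma, Finset.mem_compl, mem_signSupport, not_not,
      mem_signPatterns, Finset.mem_insert, Finset.mem_singleton] at h ⊢
    have hs : s ≠ 0 := by rcases h.2 with h | h <;> rw [h] <;> decide
    exact ⟨by rw [card_signSupport_update σ i h.1.2 s hs, h.1.1], by simpa using hs⟩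
  · rintro ⟨σ, i⟩ h
    simp only [Finset.mem_product, Finset.mem_sigma, Finset.mem_compl, mem_signSupport, not_not,
      mem_signPatterns, Finset.mem_insert, Finset.mem_singleton] at h ⊢
    have e := card_signSupport_update (Function.update σ i 0) i (by simp) (σ i) h.2
    simp only [Function.update_idem, Function.update_eq_self] at e
    refine ⟨⟨by omega, by simp⟩, ?_⟩
    have : ∀ s : SignType, s ≠ 0 → s = 1 ∨ s = -1 := by decide
    exact this _ h.2
  · rintro ⟨⟨σ, i⟩, s⟩ h
    simp only [Finset.mem_product, Finset.mem_sigma, Finset.mem_compl, mem_signSupport,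
      not_not] at h
    simp [← h.1.2]
  · rintro ⟨σ, i⟩ -
    simp
  · rintro ⟨⟨σ, i⟩, s⟩ -
    rfl

/-- If adding a signed entry at a random free place costs at least `w / 4` on average over the
places, then some pattern with `k + 1` entries has total cost at least `(k + 1) * w / 8`. -/
theorem exists_signPattern_large_sum {ι : Type*} [Fintype ι] [DecidableEq ι] (k : ℕ)
    (hk : k + 1 ≤ Fintype.card ι) (a : (ι → SignType) → ι → ℝ) (w : ℝ)
    (h : ∀ σ ∈ signPatterns ι k, ((Fintype.card ι : ℝ) - k) * (w / 4) ≤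
      ∑ i ∈ (signSupport σ)ᶜ, (a (Function.update σ i 1) i + a (Function.update σ i (-1)) i)) :
    ∃ σ ∈ signPatterns ι (k + 1), ((k : ℝ) + 1) * w / 8 ≤ ∑ i ∈ signSupport σ, a σ i := by
  by_contra! hc
  have h1 := Finset.sum_lt_sum_of_nonempty (signPatterns_nonempty ι hk) hc
  have h2 := Finset.sum_le_sum h
  rw [sum_signPatterns_succ] at h1
  -- The same identity with summand `1` counts patterns: the numbers `N k` of patterns satisfy `(k +
  -- 1) * N (k + 1) = 2 * (card ι - k) * N k`. The factor `2` turns `w / 4` into `w / 8`.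
  have e := sum_signPatterns_succ (ι := ι) k fun _ _ => 1
  have e1 : ∑ σ ∈ signPatterns ι (k + 1), ∑ _i ∈ signSupport σ, (1 : ℝ) =
      (signPatterns ι (k + 1)).card * ((k : ℝ) + 1) := by
    rw [Finset.sum_congr rfl (g := fun _ => (k : ℝ) + 1)]
    · simp
      ring
    · intro σ hσ
      rw [Finset.sum_const, mem_signPatterns.1 hσ]
      simp
  have e2 : ∑ σ ∈ signPatterns ι k, ∑ _i ∈ (signSupport σ)ᶜ, ((1 : ℝ) + 1) =
      (signPatterns ι k).card * (((Fintype.card ι : ℝ) - k) * 2) := by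
    rw [Finset.sum_congr rfl (g := fun _ => ((Fintype.card ι : ℝ) - k) * 2)]
    · simp
    · intro σ hσ
      rw [Finset.sum_const, Finset.card_compl, mem_signPatterns.1 hσ, nsmul_eq_mul,
        Nat.cast_sub (by omega)]
      norm_num
  rw [e1, e2] at e
  simp only [Finset.sum_const, nsmul_eq_mul] at h1 h2
  have h3 := h2.trans_lt h1
  have : ((signPatterns ι k).card : ℝ) * (((Fintype.card ι : ℝ) - k) * (w / 4)) =
      (signPatterns ι (k + 1)).card * ((k : ℝ) + 1) * (w / 8) := by
    rw [e]; ring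
  rw [this] at h3
  exact absurd h3 (by rw [not_lt]; apply le_of_eq; ring)

/-! ### Bump families and the lower bound for a fixed family -/

/-- A base margin function and disjointly supported bumps on which it vanishes; the `i`-th bump
is constant on the `i`-th piece. -/
structure BumpFamily (d : ℕ) (ι : Type) where
  base : Cube d → ℝ
  bump : ι → Cube d → ℝ
  piece : ι → Set (Cube d)
  height : ℝ
  measurable_base : Measurable base
  abs_base_le : ∀ x, |base x| ≤ 1
  measurable_bump : ∀ i, Measurable (bump i)
  bump_nonneg : ∀ i x, 0 ≤ bump i x
  bump_le : ∀ i x, bump i x ≤ height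
  height_pos : 0 < height
  height_le_one : height ≤ 1
  disjoint_bump : ∀ i j x, bump i x ≠ 0 → bump j x ≠ 0 → i = j
  base_mul_bump : ∀ i x, base x * bump i x = 0
  measurableSet_piece : ∀ i, MeasurableSet (piece i)
  bump_piece : ∀ i x, x ∈ piece i → bump i x = height

namespace BumpFamily

variable {ι : Type} (B : BumpFamily d ι)

theorem abs_bump_le_one (i : ι) (x : Cube d) : |B.bump i x| ≤ 1 := by
  rw [abs_of_nonneg (B.bump_nonneg i x)]
  exact (B.bump_le i x).trans B.height_le_one

theorem disjoint_piece (i j : ι) (x : Cube d) (hi : x ∈ B.piece i) (hj : x ∈ B.piece j) :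
    i = j :=
  B.disjoint_bump i j x (by rw [B.bump_piece i x hi]; exact B.height_pos.ne')
    (by rw [B.bump_piece j x hj]; exact B.height_pos.ne')

/-- A point meets at most one bump, so one query can inform about at most one of them. -/
theorem sum_bump_sq_le (s : Finset ι) (x : Cube d) :
    ∑ i ∈ s, B.bump i x ^ 2 ≤ B.height ^ 2 := by
  by_cases h : ∃ i ∈ s, B.bump i x ≠ 0
  · obtain ⟨i, his, hi⟩ := h
    rw [Finset.sum_eq_single_of_mem i his]
    · exact pow_le_pow_left₀ (B.bump_nonneg i x) (B.bump_le i x) 2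
    · intro j _ hj
      by_contra hne
      exact hj (B.disjoint_bump j i x (fun h0 => hne (by rw [h0]; norm_num)) hi)
  · push Not at h
    rw [Finset.sum_eq_zero fun i hi => by rw [h i hi]; norm_num]
    positivity

/-- The label of larger cost on a bump of sign `s`. -/
def worseLabel (s : SignType) : Fin 2 := if s = 1 then 0 else 1

/-- The mass of the part of the `i`-th piece which is given the label `y`. -/
noncomputable def labelMass (μ : Measure (Cube d)) (A : ActiveLearner d 2 n) (i : ι) (y : Fin 2)
    (s : A.Seed × (Fin n → Cube d × Costs 2)) : ℝ :=
  μ.real {x | x ∈ B.piece i ∧ A.classify (s, x) = y}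

theorem measurable_labelMass (μ : Measure (Cube d)) [IsProbabilityMeasure μ]
    (A : ActiveLearner d 2 n) (i : ι) (y : Fin 2) : Measurable (B.labelMass μ A i y) := by
  have hs : MeasurableSet {z : (A.Seed × (Fin n → Cube d × Costs 2)) × Cube d |
      z.2 ∈ B.piece i ∧ A.classify z = y} :=
    (measurable_snd (B.measurableSet_piece i)).inter
      (A.measurable_classify (measurableSet_singleton y))
  exact (measurable_measure_prodMk_left hs).ennreal_toReal

theorem labelMass_add (μ : Measure (Cube d)) [IsProbabilityMeasure μ]
    (A : ActiveLearner d 2 n) (i : ι) (s : A.Seed × (Fin n → Cube d × Costs 2)) :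
    B.labelMass μ A i 0 s + B.labelMass μ A i 1 s = μ.real (B.piece i) := by
  unfold labelMass
  have hm : ∀ y, MeasurableSet {x | x ∈ B.piece i ∧ A.classify (s, x) = y} := fun y =>
    (B.measurableSet_piece i).inter
      ((A.measurable_classify.comp measurable_prodMk_left) (measurableSet_singleton y))
  rw [← measureReal_union _ (hm 1)]
  · congr 1
    ext x
    simp only [Set.mem_union, Set.mem_ofPred_eq]
    constructor
    · rintro (h | h) <;> exact h.1
    · intro h
      by_cases h0 : A.classify (s, x) = 0
      · exact Or.inl ⟨h, h0⟩
      · exact Or.inr ⟨h, Fin.eq_one_of_ne_zero _ h0⟩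
  · rw [Set.disjoint_left]
    rintro x ⟨-, h0⟩ ⟨-, h1⟩
    rw [h0] at h1
    exact absurd h1 (by decide)

variable [Fintype ι]

/-- The margin function with the bumps added according to a sign pattern. -/
noncomputable def margin (σ : ι → SignType) (x : Cube d) : ℝ :=
  B.base x + ∑ i, (σ i : ℝ) * B.bump i x

theorem measurable_margin (σ : ι → SignType) : Measurable (B.margin σ) :=
  B.measurable_base.add (Finset.measurable_sum _ fun i _ => (B.measurable_bump i).const_mul _)

theorem margin_of_bump_ne_zero (σ : ι → SignType) (i : ι) (x : Cube d) (h : B.bump i x ≠ 0) :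
    B.margin σ x = (σ i : ℝ) * B.bump i x := by
  unfold margin
  rw [(mul_eq_zero.1 (B.base_mul_bump i x)).resolve_right h, zero_add]
  refine Finset.sum_eq_single i (fun j _ hj => ?_) (by simp)
  by_contra hne
  exact hj (B.disjoint_bump j i x (right_ne_zero_of_mul hne) h)

theorem margin_of_bump_eq_zero (σ : ι → SignType) (x : Cube d) (h : ∀ i, B.bump i x = 0) :
    B.margin σ x = B.base x := by
  simp [margin, h]

theorem abs_margin_le (σ : ι → SignType) (x : Cube d) : |B.margin σ x| ≤ 1 := by
  by_cases h : ∃ i, B.bump i x ≠ 0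
  · obtain ⟨i, hi⟩ := h
    rw [B.margin_of_bump_ne_zero σ i x hi, abs_mul, abs_of_nonneg (B.bump_nonneg i x)]
    have h1 : |(σ i : ℝ)| ≤ 1 := by
      rcases σ i with _ | _ | _ <;> simp
    exact mul_le_one₀ h1 (B.bump_nonneg i x) ((B.bump_le i x).trans B.height_le_one)
  · push Not at h
    rw [B.margin_of_bump_eq_zero σ x h]
    exact B.abs_base_le x

theorem margin_piece (σ : ι → SignType) (i : ι) (x : Cube d) (hx : x ∈ B.piece i) :
    B.margin σ x = (σ i : ℝ) * B.height := by
  have h := B.bump_piece i x hx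
  rw [B.margin_of_bump_ne_zero σ i x (by rw [h]; exact B.height_pos.ne'), h]

theorem margin_update [DecidableEq ι] (σ : ι → SignType) (i : ι) (hi : σ i = 0) (s : SignType)
    (x : Cube d) : B.margin (Function.update σ i s) x = B.margin σ x + (s : ℝ) * B.bump i x := by
  unfold margin
  rw [add_assoc]
  congr 1
  rw [← Finset.add_sum_erase _ _ (Finset.mem_univ i), ← Finset.add_sum_erase (s := Finset.univ)
    (f := fun j => (σ j : ℝ) * B.bump j x) (Finset.mem_univ i), add_comm]
  simp only [Function.update_self, hi, SignType.coe_zero, zero_mul, zero_add]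
  congr 1
  refine Finset.sum_congr rfl fun j hj => ?_
  rw [Function.update_of_ne (Finset.ne_of_mem_erase hj)]

/-- This is the orthogonality needed to perturb a pattern by a bump at a free place. -/
theorem margin_mul_bump (σ : ι → SignType) (i : ι) (hi : σ i = 0) (x : Cube d) :
    B.margin σ x * B.bump i x = 0 := by
  by_cases h : B.bump i x = 0
  · rw [h, mul_zero]
  · rw [B.margin_of_bump_ne_zero σ i x h, hi]
    simp

/-- The problem with marginal `μ` whose margin function has the bumps prescribed by `σ`. -/
noncomputable def model (μ : Measure (Cube d)) (hμ : IsProbabilityMeasure μ) (σ : ι → SignType) :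
    CostModel d 2 :=
  binaryModel μ hμ (B.margin σ) (B.measurable_margin σ) (B.abs_margin_le σ)

/-- The pieces are disjoint, so at most one term is nonzero; on a piece carrying a bump `|F|` equals
the height, which is the regret of the wrong label. -/
theorem sum_indicator_le_regret (σ : ι → SignType) (u : Cube d → Fin 2) (x : Cube d) :
    ∑ i ∈ signSupport σ, {x | x ∈ B.piece i ∧ u x = worseLabel (σ i)}.indicator
      (fun _ => B.height) x ≤ regret (B.margin σ) x (u x) := by
  by_cases h : ∃ i ∈ signSupport σ, x ∈ B.piece i ∧ u x = worseLabel (σ i)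
  · obtain ⟨i, his, hi, hu⟩ := h
    rw [Finset.sum_eq_single_of_mem i his]
    · rw [Set.indicator_of_mem (by exact ⟨hi, hu⟩), hu]
      unfold regret
      rw [B.margin_piece σ i x hi]
      rw [mem_signSupport] at his
      have hh := B.height_pos
      have : ∀ s : SignType, s ≠ 0 → s = 1 ∨ s = -1 := by decide
      rcases this _ his with h1 | h1 <;> rw [h1]
      · simp [worseLabel, abs_of_pos hh]
      · have : ¬ ((-1 : SignType) = 1) := by decide
        simp [worseLabel, abs_of_pos hh]
    · intro j _ hj
      exact Set.indicator_of_notMem (fun hx => hj (B.disjoint_piece j i x hx.1 hi)) _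
  · push Not at h
    rw [Finset.sum_eq_zero fun i hi =>
      Set.indicator_of_notMem (fun hx => h i hi hx.1 hx.2) _]
    exact regret_nonneg _ _ _

theorem sum_integral_labelMass_le (μ : Measure (Cube d)) (hμ : IsProbabilityMeasure μ)
    (A : ActiveLearner d 2 n) (σ : ι → SignType) :
    B.height * ∑ i ∈ signSupport σ,
      ∫ s, B.labelMass μ A i (worseLabel (σ i)) s ∂(A.transcriptLaw (B.model μ hμ σ) n) ≤
      A.expectedExcessRisk (B.model μ hμ σ) := by
  have hT := isProbabilityMeasure_transcriptLaw A (B.model μ hμ σ) n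
  have hl : ∀ i y s, 0 ≤ B.labelMass μ A i y s := fun i y s => measureReal_nonneg
  have hint : ∀ i y, Integrable (B.labelMass μ A i y) (A.transcriptLaw (B.model μ hμ σ) n) := by
    intro i y
    refine Integrable.of_bound (C := 1) (B.measurable_labelMass μ A i y).aestronglyMeasurable
      (.of_forall fun s => ?_)
    rw [Real.norm_eq_abs, abs_of_nonneg (hl i y s)]
    exact measureReal_le_one
  unfold ActiveLearner.expectedExcessRisk
  have hc : ∀ s, Measurable fun x => A.classify (s, x) := fun s =>
    A.measurable_classify.comp measurable_prodMk_left
  have hex : ∀ s, (B.model μ hμ σ).risk (fun x => A.classify (s, x)) -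
      (B.model μ hμ σ).risk (B.model μ hμ σ).bayes =
        ∫ x, regret (B.margin σ) x (A.classify (s, x)) ∂μ := fun s =>
    excessRisk_binaryModel μ hμ _ (B.measurable_margin σ) (B.abs_margin_le σ) _ (hc s)
  simp only [hex]
  have hjoint := measurable_regret (B.margin σ) (B.measurable_margin σ)
    (Ω := (A.Seed × (Fin n → Cube d × Costs 2)) × Cube d) measurable_snd A.measurable_classify
  have hreg : Integrable (fun s => ∫ x, regret (B.margin σ) x (A.classify (s, x)) ∂μ)
      (A.transcriptLaw (B.model μ hμ σ) n) := by
    refine Integrable.of_bound (C := 1)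
      (hjoint.stronglyMeasurable.integral_prod_right').aestronglyMeasurable
      (.of_forall fun s => ?_)
    refine (norm_integral_le_of_norm_le_const (C := 1) (.of_forall fun x => ?_)).trans (by simp)
    rw [Real.norm_eq_abs, abs_of_nonneg (regret_nonneg _ _ _)]
    exact regret_le_one _ (B.abs_margin_le σ) _ _
  rw [← integral_finsetSum _ fun i _ => hint i _, ← integral_const_mul]
  refine integral_mono ((integrable_finsetSum _ fun i _ => hint i _).const_mul _) hreg fun s => ?_
  have hms : ∀ i, MeasurableSet {x | x ∈ B.piece i ∧ A.classify (s, x) = worseLabel (σ i)} :=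
    fun i => (B.measurableSet_piece i).inter ((hc s) (measurableSet_singleton _))
  have hii : ∀ i, Integrable ({x | x ∈ B.piece i ∧ A.classify (s, x) =
      worseLabel (σ i)}.indicator fun _ => B.height) μ := fun i =>
    (integrable_const _).indicator (hms i)
  calc B.height * ∑ i ∈ signSupport σ, B.labelMass μ A i (worseLabel (σ i)) s
      = ∫ x, ∑ i ∈ signSupport σ, {x | x ∈ B.piece i ∧ A.classify (s, x) =
          worseLabel (σ i)}.indicator (fun _ => B.height) x ∂μ := by
        rw [integral_finsetSum _ fun i _ => hii i, Finset.mul_sum]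
        refine Finset.sum_congr rfl fun i _ => ?_
        rw [integral_indicator_const _ (hms i), smul_eq_mul, mul_comm]
        rfl
    _ ≤ ∫ x, regret (B.margin σ) x (A.classify (s, x)) ∂μ := by
        refine integral_mono (integrable_finsetSum _ fun i _ => hii i) ?_
          fun x => B.sum_indicator_le_regret σ (fun x => A.classify (s, x)) x
        refine Integrable.of_bound (C := 1)
          (measurable_regret (B.margin σ) (B.measurable_margin σ) measurable_id
            (hc s)).aestronglyMeasurable (.of_forall fun x => ?_)
        rw [Real.norm_eq_abs, abs_of_nonneg (regret_nonneg _ _ _)]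
        exact regret_le_one _ (B.abs_margin_le σ) _ _

/-- Every learner with few queries has a large excess risk for one of the patterns with exactly
`k + 1` bumps. -/
theorem exists_large_excessRisk [DecidableEq ι] (μ : Measure (Cube d))
    (hμ : IsProbabilityMeasure μ) (w : ℝ) (hw : ∀ i, μ.real (B.piece i) = w) (k : ℕ)
    (hk : k + 1 ≤ Fintype.card ι) (hk2 : 2 * k ≤ Fintype.card ι)
    (hn : 8 * (n * B.height ^ 2) ≤ Fintype.card ι) (A : ActiveLearner d 2 n) :
    ∃ σ ∈ signPatterns ι (k + 1),
      B.height * (((k : ℝ) + 1) * w / 8) ≤ A.expectedExcessRisk (B.model μ hμ σ) := by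
  suffices hs : _ by
    obtain ⟨σ, hσ, h⟩ := exists_signPattern_large_sum (ι := ι) k hk
      (fun σ i => ∫ s, B.labelMass μ A i (worseLabel (σ i)) s
        ∂(A.transcriptLaw (B.model μ hμ σ) n)) w hs
    exact ⟨σ, hσ, (mul_le_mul_of_nonneg_left h B.height_pos.le).trans
      (B.sum_integral_labelMass_le μ hμ A σ)⟩
  intro σ hσ
  have hT := isProbabilityMeasure_transcriptLaw A (B.model μ hμ σ) n
  have hw0 : 0 ≤ w := by
    have hpos : 0 < Fintype.card ι := by omega
    obtain ⟨i⟩ := Fintype.card_pos_iff.1 hpos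
    rw [← hw i]
    exact measureReal_nonneg
  have hint : ∀ i, Integrable (fun s : A.Seed × (Fin n → Cube d × Costs 2) =>
      ∑ u, B.bump i (s.2 u).1 ^ 2) (A.transcriptLaw (B.model μ hμ σ) n) := by
    intro i
    refine integrable_finsetSum _ fun u _ => Integrable.of_bound (C := 1)
      (((B.measurable_bump i).comp (measurable_fst.comp
        ((measurable_pi_apply u).comp measurable_snd))).pow_const 2).aestronglyMeasurable
      (.of_forall fun s => ?_)
    rw [Real.norm_eq_abs, abs_of_nonneg (sq_nonneg _)]
    exact (sq_le_one_iff_abs_le_one _).2 (B.abs_bump_le_one i _)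
  -- The budget is shared: under one and the same pattern `σ`, the energies of all free bumps
  -- together are bounded by one squared height per query.
  have hsum : ∑ i ∈ (signSupport σ)ᶜ, ∫ s, ∑ u, B.bump i (s.2 u).1 ^ 2
      ∂(A.transcriptLaw (B.model μ hμ σ) n) ≤ n * B.height ^ 2 := by
    rw [← integral_finsetSum _ fun i _ => hint i]
    have hle : ∀ s : A.Seed × (Fin n → Cube d × Costs 2),
        ∑ i ∈ (signSupport σ)ᶜ, ∑ u, B.bump i (s.2 u).1 ^ 2 ≤ n * B.height ^ 2 := by
      intro s
      rw [Finset.sum_comm]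
      refine (Finset.sum_le_sum fun u _ => B.sum_bump_sq_le _ _).trans ?_
      simp
    refine (integral_mono (integrable_finsetSum _ fun i _ => hint i) (integrable_const _)
      hle).trans ?_
    simp
  have hcard : ((signSupport σ)ᶜ.card : ℝ) = (Fintype.card ι : ℝ) - k := by
    rw [Finset.card_compl, mem_signPatterns.1 hσ, Nat.cast_sub (by omega)]
  have htwo : ∀ i ∈ (signSupport σ)ᶜ,
      w * (3 / 8 - (∫ s, ∑ u, B.bump i (s.2 u).1 ^ 2
        ∂(A.transcriptLaw (B.model μ hμ σ) n)) / 2) ≤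
      (∫ s, B.labelMass μ A i (worseLabel (Function.update σ i 1 i)) s
        ∂(A.transcriptLaw (B.model μ hμ (Function.update σ i 1)) n)) +
      ∫ s, B.labelMass μ A i (worseLabel (Function.update σ i (-1) i)) s
        ∂(A.transcriptLaw (B.model μ hμ (Function.update σ i (-1))) n) := by
    intro i hi
    rw [Finset.mem_compl, mem_signSupport, not_not] at hi
    have l1 : worseLabel (Function.update σ i 1 i) = 0 := by simp [worseLabel]
    have l2 : worseLabel (Function.update σ i (-1) i) = 1 := by
      rw [Function.update_self]
      decide
    rw [l1, l2]
    exact two_point_lower_bound A μ hμ (B.margin σ) _ _ (B.bump i) _ _ _ _ _ _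
      (B.measurable_bump i) (B.abs_bump_le_one i)
      (fun x => by rw [B.margin_update σ i hi]; simp)
      (fun x => by rw [B.margin_update σ i hi]; simp [sub_eq_add_neg])
      (B.margin_mul_bump σ i hi) n _ _ w (B.measurable_labelMass μ A i 0)
      (B.measurable_labelMass μ A i 1) (fun _ => measureReal_nonneg) (fun _ => measureReal_nonneg)
      (fun s => by rw [B.labelMass_add μ A i s, hw i])
  refine le_trans ?_ (Finset.sum_le_sum htwo)
  rw [← Finset.mul_sum, Finset.sum_sub_distrib, Finset.sum_const, nsmul_eq_mul, hcard,
    ← Finset.sum_div]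
  have hk2' : 2 * (k : ℝ) ≤ Fintype.card ι := by exact_mod_cast hk2
  -- The claim is `n * height ^ 2 / 2 ≤ (card ι - k) / 8`, which follows from `hn` because at least
  -- half of the places are free.
  nlinarith

end BumpFamily

/-! ### The cube in the maximum norm and Lebesgue measure of boxes -/

theorem abs_rpow_sub_rpow_le {a b α : ℝ} (ha : 0 ≤ a) (hb : 0 ≤ b) (hα0 : 0 ≤ α) (hα1 : α ≤ 1) :
    |a ^ α - b ^ α| ≤ |a - b| ^ α := by
  have key : ∀ a b : ℝ, 0 ≤ b → b ≤ a → a ^ α - b ^ α ≤ (a - b) ^ α := by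
    intro a b hb hab
    have := Real.rpow_add_le_add_rpow hb (sub_nonneg.2 hab) hα0 hα1
    rw [add_sub_cancel] at this
    linarith
  rcases le_total b a with h | h
  · rw [abs_of_nonneg (sub_nonneg.2 (Real.rpow_le_rpow hb h hα0)), abs_of_nonneg (sub_nonneg.2 h)]
    exact key a b hb h
  · rw [abs_sub_comm, abs_sub_comm a,
      abs_of_nonneg (sub_nonneg.2 (Real.rpow_le_rpow ha h hα0)), abs_of_nonneg (sub_nonneg.2 h)]
    exact key b a ha h

/-- The distance in the maximum norm from a point of the cube to a point of the space. -/
noncomputable def maxDist (x : Cube d) (z : Fin d → ℝ) : ℝ := dist (WithLp.ofLp x.1) z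

theorem maxDist_nonneg (x : Cube d) (z : Fin d → ℝ) : 0 ≤ maxDist x z := dist_nonneg

theorem maxDist_le_iff {x : Cube d} {z : Fin d → ℝ} {r : ℝ} (hr : 0 ≤ r) :
    maxDist x z ≤ r ↔ ∀ k, |x.1 k - z k| ≤ r := by
  simp [maxDist, dist_pi_le_iff hr, Real.dist_eq]

theorem abs_maxDist_sub_le (x y : Cube d) (z : Fin d → ℝ) :
    |maxDist x z - maxDist y z| ≤ dist x y := by
  refine (abs_dist_sub_le _ _ _).trans ?_
  rw [Subtype.dist_eq]
  simpa using (PiLp.lipschitzWith_ofLp 2 (fun _ : Fin d => ℝ)).dist_le_mul x.1 y.1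

theorem measurable_maxDist (z : Fin d → ℝ) : Measurable fun x : Cube d => maxDist x z := by
  refine Continuous.measurable ?_
  unfold maxDist
  fun_prop

theorem abs_maxDist_rpow_sub_le {α : ℝ} (hα0 : 0 ≤ α) (hα1 : α ≤ 1) (x y : Cube d)
    (z : Fin d → ℝ) : |maxDist x z ^ α - maxDist y z ^ α| ≤ dist x y ^ α :=
  (abs_rpow_sub_rpow_le (maxDist_nonneg _ _) (maxDist_nonneg _ _) hα0 hα1).trans
    (Real.rpow_le_rpow (abs_nonneg _) (abs_maxDist_sub_le x y z) hα0)

theorem measurable_coord (k : Fin d) : Measurable fun x : Cube d => x.1 k := by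
  refine Continuous.measurable ?_
  fun_prop

/-- The axis-parallel box with corners `a` and `b`. -/
def box (a b : Fin d → ℝ) : Set (Cube d) := {x | ∀ k, x.1 k ∈ Set.Icc (a k) (b k)}

theorem measurableSet_box (a b : Fin d → ℝ) : MeasurableSet (box a b) := by
  have : box a b = ⋂ k, (fun x : Cube d => x.1 k) ⁻¹' Set.Icc (a k) (b k) := by
    ext x; simp [box]
  rw [this]
  exact MeasurableSet.iInter fun k => measurable_coord k measurableSet_Icc

theorem measurableSet_cube (d : ℕ) :
    MeasurableSet {x : EuclideanSpace ℝ (Fin d) | ∀ i, x i ∈ Set.Icc (0 : ℝ) 1} := by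
  have : {x : EuclideanSpace ℝ (Fin d) | ∀ i, x i ∈ Set.Icc (0 : ℝ) 1} =
      ⋂ k, (fun x : EuclideanSpace ℝ (Fin d) => x k) ⁻¹' Set.Icc (0 : ℝ) 1 := by
    ext x; simp
  rw [this]
  refine MeasurableSet.iInter fun k => ?_
  have hm : Measurable fun x : EuclideanSpace ℝ (Fin d) => x k :=
    Continuous.measurable (by fun_prop)
  exact hm measurableSet_Icc

theorem lebesgue_box (a b : Fin d → ℝ) (ha : ∀ k, 0 ≤ a k) (hb : ∀ k, b k ≤ 1) :
    lebesgue d (box a b) = ∏ k, ENNReal.ofReal (b k - a k) := by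
  have himg : Subtype.val '' (box a b) = WithLp.ofLp ⁻¹' (Set.Icc a b) := by
    ext x
    simp only [Set.mem_image, Set.mem_preimage, Set.mem_Icc, Pi.le_def]
    constructor
    · rintro ⟨y, hy, rfl⟩
      exact ⟨fun k => (hy k).1, fun k => (hy k).2⟩
    · rintro ⟨h1, h2⟩
      exact ⟨⟨x, fun k => ⟨(ha k).trans (h1 k), (h2 k).trans (hb k)⟩⟩,
        fun k => ⟨h1 k, h2 k⟩, rfl⟩
  refine ((MeasurableEmbedding.subtype_coe (measurableSet_cube d)).comap_apply volume
    (box a b)).trans ((congrArg volume himg).trans ?_)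
  rw [(PiLp.volume_preserving_ofLp (Fin d)).measure_preimage measurableSet_Icc.nullMeasurableSet,
    Real.volume_Icc_pi]

theorem lebesgue_real_box (a b : Fin d → ℝ) (ha : ∀ k, 0 ≤ a k) (hab : ∀ k, a k ≤ b k)
    (hb : ∀ k, b k ≤ 1) : (lebesgue d).real (box a b) = ∏ k, (b k - a k) := by
  rw [measureReal_def, lebesgue_box a b ha hb,
    ← ENNReal.ofReal_prod_of_nonneg fun k _ => sub_nonneg.2 (hab k),
    ENNReal.toReal_ofReal (Finset.prod_nonneg fun k _ => sub_nonneg.2 (hab k))]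

theorem isProbabilityMeasure_lebesgue (d : ℕ) : IsProbabilityMeasure (lebesgue d) := by
  refine ⟨?_⟩
  have : (Set.univ : Set (Cube d)) = box (fun _ => 0) (fun _ => 1) := by
    ext x
    simpa [box] using x.2
  rw [this, lebesgue_box _ _ (fun _ => le_refl _) (fun _ => le_refl _)]
  simp

theorem maxDist_zero_le_one (x : Cube d) : maxDist x 0 ≤ 1 := by
  rw [maxDist_le_iff zero_le_one]
  intro k
  have := x.2 k
  rw [Pi.zero_apply, sub_zero, abs_of_nonneg this.1]
  exact this.2

theorem lebesgue_real_maxDist_le {s : ℝ} (hs0 : 0 ≤ s) (hs1 : s ≤ 1) :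
    (lebesgue d).real {x | maxDist x 0 ≤ s} = s ^ d := by
  have : {x : Cube d | maxDist x 0 ≤ s} = box (fun _ => 0) (fun _ => s) := by
    ext x
    simp only [Set.mem_ofPred_eq, maxDist_le_iff hs0, box, Pi.zero_apply, sub_zero, Set.mem_Icc]
    exact forall_congr' fun k => by
      rw [abs_of_nonneg (x.2 k).1]
      exact ⟨fun h => ⟨(x.2 k).1, h⟩, fun h => h.2⟩
  rw [this, lebesgue_real_box _ _ (fun _ => le_refl _) (fun _ => hs0) (fun _ => hs1)]
  simp

/-! ### Bumps on a grid -/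

/-- The margin function away from the bumps: zero near the origin, then growing like
`‖x‖ ^ α`. -/
noncomputable def cornerMargin (α ρ : ℝ) (x : Cube d) : ℝ := max 0 (maxDist x 0 ^ α - ρ ^ α)

/-- A bump of height at most `v`, supported in the ball of radius `h / 2` around `z`. -/
noncomputable def bumpAt (α h v : ℝ) (z : Fin d → ℝ) (x : Cube d) : ℝ :=
  max 0 (min v (((h / 2) ^ α - maxDist x z ^ α) / 4))

theorem abs_cornerMargin_sub_le {α : ℝ} (hα0 : 0 ≤ α) (hα1 : α ≤ 1) (ρ : ℝ) (x y : Cube d) :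
    |cornerMargin α ρ x - cornerMargin α ρ y| ≤ dist x y ^ α := by
  unfold cornerMargin
  rw [max_comm 0, max_comm 0]
  refine (abs_max_sub_max_le_abs _ _ _).trans ?_
  rw [sub_sub_sub_cancel_right]
  exact abs_maxDist_rpow_sub_le hα0 hα1 x y 0

theorem abs_bumpAt_sub_le {α : ℝ} (hα0 : 0 ≤ α) (hα1 : α ≤ 1) (h v : ℝ) (z : Fin d → ℝ)
    (x y : Cube d) : |bumpAt α h v z x - bumpAt α h v z y| ≤ dist x y ^ α / 4 := by
  have h1 := abs_maxDist_rpow_sub_le hα0 hα1 x y z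
  unfold bumpAt
  have h2 := abs_max_sub_max_le_max 0 (min v (((h / 2) ^ α - maxDist x z ^ α) / 4)) 0
    (min v (((h / 2) ^ α - maxDist y z ^ α) / 4))
  have h3 := abs_min_sub_min_le_max v (((h / 2) ^ α - maxDist x z ^ α) / 4) v
    (((h / 2) ^ α - maxDist y z ^ α) / 4)
  simp only [sub_self, abs_zero, abs_nonneg, max_eq_right] at h2 h3
  refine h2.trans (h3.trans ?_)
  rw [← sub_div, sub_sub_sub_cancel_left, abs_div, abs_sub_comm]
  norm_num
  linarith

theorem maxDist_lt_of_bumpAt_ne_zero {α h v : ℝ} (hα : 0 ≤ α) {z : Fin d → ℝ} {x : Cube d}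
    (hh : 0 ≤ h) (hx : bumpAt α h v z x ≠ 0) : maxDist x z < h / 2 := by
  by_contra! hc
  apply hx
  have := Real.rpow_le_rpow (by positivity) hc hα
  exact max_eq_left ((min_le_right _ _).trans (by linarith))

/-- The bottom corner of a cell of the grid of mesh `h`. -/
def gridPoint {q : ℕ} (h : ℝ) (i : Fin d → Fin q) : Fin d → ℝ := fun k => (i k : ℝ) * h

theorem gridPoint_add_le {q : ℕ} {h : ℝ} (hh : 0 ≤ h) (i : Fin d → Fin q) (k : Fin d) :
    gridPoint h i k + h ≤ q * h := by
  have : ((i k : ℕ) : ℝ) + 1 ≤ q := by exact_mod_cast (i k).2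
  unfold gridPoint
  nlinarith

theorem gridPoint_nonneg {q : ℕ} {h : ℝ} (hh : 0 ≤ h) (i : Fin d → Fin q) (k : Fin d) :
    0 ≤ gridPoint h i k := mul_nonneg (Nat.cast_nonneg _) hh

/-- Distinct grid points are at maximum-norm distance at least `h`, so their open balls of radius `h
/ 2` are disjoint. -/
theorem eq_of_maxDist_gridPoint_lt {q : ℕ} {h : ℝ} (hh : 0 ≤ h) (i j : Fin d → Fin q) (x : Cube d)
    (hi : maxDist x (gridPoint h i) < h / 2) (hj : maxDist x (gridPoint h j) < h / 2) : i = j := by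
  by_contra hne
  obtain ⟨k, hk⟩ := Function.ne_iff.1 hne
  have h1 : dist (gridPoint h i) (gridPoint h j) < h := by
    refine (dist_triangle_left _ _ (WithLp.ofLp x.1)).trans_lt ?_
    unfold maxDist at hi hj
    linarith
  have h2 := (dist_le_pi_dist (gridPoint h i) (gridPoint h j) k).trans_lt h1
  rw [Real.dist_eq] at h2
  unfold gridPoint at h2
  rw [← sub_mul, abs_mul, abs_of_nonneg hh] at h2
  have h3 : (1 : ℝ) ≤ |((i k : ℕ) : ℝ) - ((j k : ℕ) : ℝ)| := by
    have : (1 : ℤ) ≤ |((i k : ℕ) : ℤ) - ((j k : ℕ) : ℤ)| := by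
      refine Int.one_le_abs (sub_ne_zero.2 fun he => hk (Fin.ext ?_))
      exact_mod_cast he
    exact_mod_cast this
  nlinarith

theorem maxDist_zero_le_of_near {q : ℕ} {h : ℝ} (hh : 0 ≤ h) (i : Fin d → Fin q) (x : Cube d)
    (hi : maxDist x (gridPoint h i) ≤ h) : maxDist x 0 ≤ q * h := by
  rw [maxDist_le_iff (by positivity)]
  rw [maxDist_le_iff hh] at hi
  intro k
  rw [Pi.zero_apply, sub_zero, abs_of_nonneg (x.2 k).1]
  linarith [(abs_le.1 (hi k)).2, gridPoint_add_le hh i k]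

/-- The box of side `θ h` at the bottom corner of a cell. -/
def cellPiece {q : ℕ} (h θ : ℝ) (i : Fin d → Fin q) : Set (Cube d) :=
  box (gridPoint h i) fun k => gridPoint h i k + θ * h

theorem maxDist_le_of_mem_cellPiece {q : ℕ} {h θ : ℝ} (hh : 0 ≤ h) (hθ : 0 ≤ θ)
    (i : Fin d → Fin q) {x : Cube d} (hx : x ∈ cellPiece h θ i) :
    maxDist x (gridPoint h i) ≤ θ * h := by
  rw [maxDist_le_iff (by positivity)]
  intro k
  have := hx k
  rw [abs_of_nonneg (sub_nonneg.2 this.1)]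
  linarith [this.2]

/-- The ratio between the height of a bump and `h ^ α`, where `h` is the mesh of the grid. -/
noncomputable def heightRatio (α : ℝ) : ℝ := ((1 / 2) ^ α - (1 / 4) ^ α) / 4

theorem heightRatio_pos {α : ℝ} (hα : 0 < α) : 0 < heightRatio α := by
  have := Real.rpow_lt_rpow (by norm_num : (0 : ℝ) ≤ 1 / 4) (by norm_num : (1 / 4 : ℝ) < 1 / 2) hα
  unfold heightRatio
  linarith

theorem heightRatio_le_one {α : ℝ} (hα : 0 < α) : heightRatio α ≤ 1 := by
  have h1 := Real.rpow_le_one (by norm_num : (0 : ℝ) ≤ 1 / 2) (by norm_num) hα.le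
  have h2 := Real.rpow_nonneg (by norm_num : (0 : ℝ) ≤ 1 / 4) α
  unfold heightRatio
  linarith

/-- The truncation level is the value of the untruncated profile at distance `h / 4`, so the bump
has a plateau there. -/
theorem bumpAt_eq_height {α h : ℝ} (hα : 0 < α) (hh : 0 < h) {z : Fin d → ℝ} {x : Cube d}
    (hx : maxDist x z ≤ h / 4) : bumpAt α h (heightRatio α * h ^ α) z x = heightRatio α * h ^ α := by
  have h1 := Real.rpow_le_rpow (maxDist_nonneg x z) hx hα.le
  have e2 : (h / 2) ^ α = (1 / 2) ^ α * h ^ α := by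
    rw [← Real.mul_rpow (by norm_num) hh.le]; ring_nf
  have e4 : (h / 4) ^ α = (1 / 4) ^ α * h ^ α := by
    rw [← Real.mul_rpow (by norm_num) hh.le]; ring_nf
  have hle : heightRatio α * h ^ α ≤ ((h / 2) ^ α - maxDist x z ^ α) / 4 := by
    rw [e4] at h1
    rw [e2]
    unfold heightRatio
    linarith
  unfold bumpAt
  rw [min_eq_left hle, max_eq_right]
  exact mul_nonneg (heightRatio_pos hα).le (Real.rpow_nonneg hh.le _)

/-- Bumps at the points of a grid with `q ^ d` cells in the cube of side `ρ`. -/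
noncomputable def gridBumps (d q : ℕ) (α ρ θ : ℝ) (hα : α ∈ Set.Ioo (0 : ℝ) 1)
    (hρ : ρ ∈ Set.Ioo (0 : ℝ) 1) (hθ : 0 < θ ∧ θ ≤ 1 / 4) (hq : 0 < q) :
    BumpFamily d (Fin d → Fin q) :=
  have hq' : (0 : ℝ) < q := by exact_mod_cast hq
  have hh : 0 < ρ / q := div_pos hρ.1 hq'
  have hqh : q * (ρ / q) = ρ := by field_simp
  { base := cornerMargin α ρ
    bump := fun i => bumpAt α (ρ / q) (heightRatio α * (ρ / q) ^ α) (gridPoint (ρ / q) i)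
    piece := cellPiece (ρ / q) θ
    height := heightRatio α * (ρ / q) ^ α
    measurable_base :=
      measurable_const.max (((measurable_maxDist 0).pow_const α).sub_const _)
    abs_base_le := fun x => by
      unfold cornerMargin
      rw [abs_of_nonneg (le_max_left _ _)]
      refine max_le zero_le_one ?_
      have h1 := Real.rpow_le_one (maxDist_nonneg x 0) (maxDist_zero_le_one x) hα.1.le
      linarith [Real.rpow_nonneg hρ.1.le α]
    measurable_bump := fun i => measurable_const.max (measurable_const.min
      ((measurable_const.sub ((measurable_maxDist _).pow_const α)).div_const 4))
    bump_nonneg := fun i x => le_max_left _ _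
    bump_le := fun i x => max_le
      (mul_nonneg (heightRatio_pos hα.1).le (Real.rpow_nonneg hh.le _)) (min_le_left _ _)
    height_pos := mul_pos (heightRatio_pos hα.1) (Real.rpow_pos_of_pos hh _)
    height_le_one := mul_le_one₀ (heightRatio_le_one hα.1) (Real.rpow_nonneg hh.le _)
      (Real.rpow_le_one hh.le ((div_le_self hρ.1.le (by exact_mod_cast hq)).trans hρ.2.le) hα.1.le)
    disjoint_bump := fun i j x hi hj => eq_of_maxDist_gridPoint_lt hh.le i j x
      (maxDist_lt_of_bumpAt_ne_zero hα.1.le hh.le hi)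
      (maxDist_lt_of_bumpAt_ne_zero hα.1.le hh.le hj)
    base_mul_bump := fun i x => by
      by_cases hx : bumpAt α (ρ / q) (heightRatio α * (ρ / q) ^ α) (gridPoint (ρ / q) i) x = 0
      · rw [hx, mul_zero]
      · have h1 := maxDist_lt_of_bumpAt_ne_zero hα.1.le hh.le hx
        have h2 := maxDist_zero_le_of_near hh.le i x (by linarith)
        rw [hqh] at h2
        have h3 := Real.rpow_le_rpow (maxDist_nonneg x 0) h2 hα.1.le
        rw [cornerMargin, max_eq_left (by linarith), zero_mul]
    measurableSet_piece := fun i => measurableSet_box _ _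
    bump_piece := fun i x hx => bumpAt_eq_height hα.1 hh
      ((maxDist_le_of_mem_cellPiece hh.le hθ.1.le i hx).trans (by nlinarith [hθ.2])) }

/-- Only the bump met by `x` and the one met by `y` can change, each by at most a quarter of `dist x
y ^ α`; the base contributes `1`. The constant stays bounded however many bumps there are. The `2`
is affordable because the mean costs are halves of the margin. -/
theorem abs_margin_gridBumps_sub_le {q : ℕ} {α ρ θ : ℝ} (hα : α ∈ Set.Ioo (0 : ℝ) 1)
    (hρ : ρ ∈ Set.Ioo (0 : ℝ) 1) (hθ : 0 < θ ∧ θ ≤ 1 / 4) (hq : 0 < q)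
    (σ : (Fin d → Fin q) → SignType) (x y : Cube d) :
    |(gridBumps d q α ρ θ hα hρ hθ hq).margin σ x - (gridBumps d q α ρ θ hα hρ hθ hq).margin σ y| ≤
      2 * dist x y ^ α := by
  set B := gridBumps d q α ρ θ hα hρ hθ hq with hB
  classical
  have hD : 0 ≤ dist x y ^ α := Real.rpow_nonneg dist_nonneg _
  have hbase : |B.base x - B.base y| ≤ dist x y ^ α :=
    abs_cornerMargin_sub_le hα.1.le hα.2.le ρ x y
  have hbump : ∀ i, |B.bump i x - B.bump i y| ≤ dist x y ^ α / 4 := fun i =>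
    abs_bumpAt_sub_le hα.1.le hα.2.le _ _ _ x y
  have hone : ∀ z : Cube d, ∑ i, (if B.bump i z ≠ 0 then dist x y ^ α / 4 else 0) ≤
      dist x y ^ α / 4 := by
    intro z
    by_cases h : ∃ i, B.bump i z ≠ 0
    · obtain ⟨i, hi⟩ := h
      rw [Finset.sum_eq_single i, if_pos hi]
      · intro j _ hj
        exact if_neg fun hne => hj (B.disjoint_bump j i z hne hi)
      · simp
    · push Not at h
      simp only [h, ne_eq, not_true_eq_false, if_false, Finset.sum_const_zero]
      positivity
  have hsum : |∑ i, ((σ i : ℝ) * B.bump i x - (σ i : ℝ) * B.bump i y)| ≤ dist x y ^ α / 2 := by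
    refine (Finset.abs_sum_le_sum_abs _ _).trans ?_
    have hterm : ∀ i ∈ Finset.univ, |(σ i : ℝ) * B.bump i x - (σ i : ℝ) * B.bump i y| ≤
        (if B.bump i x ≠ 0 then dist x y ^ α / 4 else 0) +
          (if B.bump i y ≠ 0 then dist x y ^ α / 4 else 0) := by
      intro i _
      have hσ : |(σ i : ℝ)| ≤ 1 := by
        rcases σ i with _ | _ | _ <;> simp
      rw [← mul_sub, abs_mul]
      have h1 : |(σ i : ℝ)| * |B.bump i x - B.bump i y| ≤ |B.bump i x - B.bump i y| :=
        mul_le_of_le_one_left (abs_nonneg _) hσ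
      have h2 := hbump i
      by_cases hx : B.bump i x = 0 <;> by_cases hy : B.bump i y = 0
      · simp [hx, hy]
      all_goals
        simp only [hx, hy, ne_eq, not_true_eq_false, not_false_eq_true, if_true, if_false] at h1 h2 ⊢
        linarith
    refine (Finset.sum_le_sum hterm).trans ?_
    rw [Finset.sum_add_distrib]
    linarith [hone x, hone y]
  have e : B.margin σ x - B.margin σ y =
      (B.base x - B.base y) + ∑ i, ((σ i : ℝ) * B.bump i x - (σ i : ℝ) * B.bump i y) := by
    rw [Finset.sum_sub_distrib]
    unfold BumpFamily.margin
    ring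
  rw [e]
  refine (abs_add_le _ _).trans ?_
  linarith

/-! ### The two notions of gap for two labels -/

section gap

variable (μ : Measure (Cube d)) (hμ : IsProbabilityMeasure μ)
    (F : Cube d → ℝ) (hF : Measurable F) (hF1 : ∀ x, |F x| ≤ 1)

theorem labelGap_binaryModel (x : Cube d) (y : Fin 2) :
    (binaryModel μ hμ F hF hF1).labelGap x y = regret F x y := by
  have hmin : ⨅ y', (binaryModel μ hμ F hF hF1).meanCost x y' = (1 - |F x|) / 2 := by
    refine le_antisymm ?_ (le_ciInf fun y' => ?_)
    · rcases le_total 0 (F x) with h | h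
      · refine (ciInf_le (Set.finite_range _).bddBelow 1).trans ?_
        rw [meanCost_binaryModel, abs_of_nonneg h]
        simp [sub_eq_add_neg]
      · refine (ciInf_le (Set.finite_range _).bddBelow 0).trans ?_
        rw [meanCost_binaryModel, abs_of_nonpos h]
        simp
    · rw [meanCost_binaryModel]
      split_ifs
      · linarith [neg_abs_le (F x)]
      · linarith [le_abs_self (F x)]
  unfold CostModel.labelGap regret
  rw [hmin, meanCost_binaryModel]
  ring

/-- A positive regret always equals `|F x|`, and where `F` vanishes the gap is `⊤`. The strict
inequality `0 < |F x|` is what exempts the cells without a bump from the first margin condition. -/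
theorem abs_le_of_gap_le (x : Cube d) (ε : ℝ) (h : (binaryModel μ hμ F hF hF1).gap x ≤ (ε : EReal)) :
    0 < |F x| ∧ |F x| ≤ ε := by
  by_contra hc
  have hreg : ∀ y, 0 < regret F x y → ε < |F x| ∧ regret F x y = |F x| := by
    intro y hy
    have hne : 0 < |F x| := by
      unfold regret at hy
      split_ifs at hy <;> linarith [le_abs_self (F x), neg_abs_le (F x)]
    refine ⟨lt_of_not_ge fun hle => hc ⟨hne, hle⟩, ?_⟩
    unfold regret at hy ⊢
    rcases le_total 0 (F x) with h0 | h0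
    · rw [abs_of_nonneg h0] at hy ⊢
      split_ifs at hy ⊢ <;> linarith
    · rw [abs_of_nonpos h0] at hy ⊢
      split_ifs at hy ⊢ <;> linarith
  by_cases hex : ∃ y, 0 < regret F x y
  · obtain ⟨y, hy⟩ := hex
    have h1 : ((|F x| : ℝ) : EReal) ≤ (binaryModel μ hμ F hF hF1).gap x := by
      unfold CostModel.gap
      simp only [labelGap_binaryModel]
      exact le_iInf₂ fun y' hy' => by rw [(hreg y' hy').2]
    have h2 := EReal.coe_le_coe_iff.1 (h1.trans h)
    linarith [(hreg y hy).1]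
  · push Not at hex
    have h1 : (⊤ : EReal) ≤ (binaryModel μ hμ F hF hF1).gap x := by
      unfold CostModel.gap
      simp only [labelGap_binaryModel]
      exact le_iInf₂ fun y' hy' => absurd hy' (not_lt.2 (hex y'))
    exact absurd (top_le_iff.1 (h1.trans h)) (EReal.coe_ne_top ε)

theorem gap'_binaryModel (x : Cube d) : (binaryModel μ hμ F hF hF1).gap' x = |F x| := by
  set P := binaryModel μ hμ F hF hF1
  have hmono : P.sortedCost x 0 ≤ P.sortedCost x 1 :=
    Tuple.monotone_sort (P.meanCost x) (by decide)
  have hdiff : P.meanCost x 0 - P.meanCost x 1 = F x := by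
    rw [meanCost_binaryModel, meanCost_binaryModel]
    simp
    ring
  change P.sortedCost x 1 - P.sortedCost x 0 = |F x|
  unfold CostModel.sortedCost at hmono ⊢
  simp only [Function.comp_apply] at hmono ⊢
  have hinj := (Tuple.sort (P.meanCost x)).injective.ne (by decide : (0 : Fin 2) ≠ 1)
  have hcases : ∀ a b : Fin 2, a ≠ b → (a = 0 ∧ b = 1) ∨ (a = 1 ∧ b = 0) := by decide
  rcases hcases _ _ hinj with ⟨h0, h1⟩ | ⟨h0, h1⟩ <;> rw [h0, h1] at hmono ⊢ <;> rw [← hdiff]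
  · rw [abs_of_nonpos (by linarith)]
    ring
  · rw [abs_of_nonneg (by linarith)]

end gap

/-! ### Uniform marginals and their supports -/

theorem real_cond_apply {S : Set (Cube d)} (hS : MeasurableSet S) (E : Set (Cube d)) :
    (cond (lebesgue d) S).real E =
      ((lebesgue d).real S)⁻¹ * (lebesgue d).real (S ∩ E) := by
  rw [measureReal_def, cond_apply hS, ENNReal.toReal_mul, ENNReal.toReal_inv]
  rfl

theorem cond_real_le {S : Set (Cube d)} (hS : MeasurableSet S) {b : ℝ}
    (hb : ((lebesgue d).real S)⁻¹ ≤ b) (E : Set (Cube d)) :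
    (cond (lebesgue d) S).real E ≤ b * (lebesgue d).real (S ∩ E) := by
  rw [real_cond_apply hS]
  exact mul_le_mul_of_nonneg_right hb measureReal_nonneg

theorem cond_eq_withDensity {S : Set (Cube d)} (hS : MeasurableSet S)
    (h0 : 0 < (lebesgue d).real S) :
    cond (lebesgue d) S = (lebesgue d).withDensity fun x =>
      ENNReal.ofReal (S.indicator (fun _ => ((lebesgue d).real S)⁻¹) x) := by
  have hp := isProbabilityMeasure_lebesgue d
  have e : (fun x => ENNReal.ofReal (S.indicator (fun _ => ((lebesgue d).real S)⁻¹) x)) =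
      S.indicator fun _ => (lebesgue d S)⁻¹ := by
    funext x
    by_cases hx : x ∈ S
    · rw [Set.indicator_of_mem hx, Set.indicator_of_mem hx, ENNReal.ofReal_inv_of_pos h0,
        measureReal_def, ENNReal.ofReal_toReal (measure_ne_top _ _)]
    · rw [Set.indicator_of_notMem hx, Set.indicator_of_notMem hx, ENNReal.ofReal_zero]
  rw [e, withDensity_indicator hS, withDensity_const]
  rfl

/-- The density is `1 / λ(S)` on `S`, which is at least `1` because `λ(S) ≤ 1`. -/
theorem strongDensity_of_marginal_eq_cond (P : CostModel d 2) {S : Set (Cube d)}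
    (hS : MeasurableSet S) (h0 : 0 < (lebesgue d).real S) {μmin μmax : ℝ} (hmin : μmin ≤ 1)
    (hmax : ((lebesgue d).real S)⁻¹ ≤ μmax) (hP : P.marginal = cond (lebesgue d) S) :
    P.StrongDensity μmin μmax := by
  have hp := isProbabilityMeasure_lebesgue d
  refine ⟨S.indicator fun _ => ((lebesgue d).real S)⁻¹, measurable_const.indicator hS,
    fun x => Set.indicator_nonneg (fun _ _ => inv_nonneg.2 h0.le) x,
    hP.trans (cond_eq_withDensity hS h0), fun x hx => ?_⟩
  have hxS : x ∈ S := Set.mem_of_indicator_ne_zero hx.ne'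
  rw [Set.indicator_of_mem hxS]
  exact ⟨hmin.trans (one_le_inv₀ h0 |>.2 measureReal_le_one), hmax⟩

/-- The support of the marginal: the pieces of all cells, and the points far from the origin. -/
def gridSupport (d q : ℕ) (ρ' h θ : ℝ) : Set (Cube d) :=
  {x | ρ' ≤ maxDist x 0} ∪ ⋃ i : Fin d → Fin q, cellPiece h θ i

theorem measurableSet_gridSupport (d q : ℕ) (ρ' h θ : ℝ) :
    MeasurableSet (gridSupport d q ρ' h θ) :=
  (measurableSet_le measurable_const (measurable_maxDist 0)).union
    (MeasurableSet.iUnion fun _ => measurableSet_box _ _)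

theorem one_sub_le_lebesgue_gridSupport (d q : ℕ) {ρ' : ℝ} (h θ : ℝ) (h0 : 0 ≤ ρ') (h1 : ρ' ≤ 1) :
    1 - ρ' ^ d ≤ (lebesgue d).real (gridSupport d q ρ' h θ) := by
  have hp := isProbabilityMeasure_lebesgue d
  have hm : MeasurableSet {x : Cube d | maxDist x 0 ≤ ρ'} :=
    measurableSet_le (measurable_maxDist 0) measurable_const
  rw [← lebesgue_real_maxDist_le (d := d) h0 h1, ← probReal_compl_eq_one_sub hm]
  refine measureReal_mono fun x hx => Or.inl ?_
  simp only [Set.mem_compl_iff, Set.mem_ofPred_eq, not_le] at hx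
  exact hx.le

theorem lebesgue_real_cellPiece {q : ℕ} {h θ : ℝ} (hh : 0 ≤ h) (hqh : q * h ≤ 1) (hθ0 : 0 ≤ θ)
    (hθ1 : θ ≤ 1) (i : Fin d → Fin q) :
    (lebesgue d).real (cellPiece h θ i) = (θ * h) ^ d := by
  have hle : θ * h ≤ h := mul_le_of_le_one_left hh hθ1
  unfold cellPiece
  rw [lebesgue_real_box _ _ (gridPoint_nonneg hh i)
    (fun k => le_add_of_nonneg_right (by positivity))
    (fun k => by linarith [gridPoint_add_le hh i k])]
  simp

/-- Lebesgue measure of the region where the margin is positive but small. -/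
theorem lebesgue_real_outer_le {α β ρ ρ' t ε : ℝ} (hα : 0 < α) (hαβ : α * β ≤ d)
    (hρ : 0 < ρ) (ht : 1 < t) (hρ' : ρ' ^ α = ρ ^ α * (t / (t - 1))) (h0' : 0 ≤ ρ') (hε : 0 < ε)
    (htε : t * ε ≤ 1) :
    (lebesgue d).real {x | ρ' ≤ maxDist x 0 ∧ cornerMargin α ρ x ≤ ε} ≤ (t * ε) ^ β := by
  have hp := isProbabilityMeasure_lebesgue d
  have htpos : 0 < t := by linarith
  have hs0 : 0 ≤ (t * ε) ^ α⁻¹ := by positivity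
  have hs1 : (t * ε) ^ α⁻¹ ≤ 1 := Real.rpow_le_one (by positivity) htε (by positivity)
  refine (measureReal_mono (s₂ := {x | maxDist x 0 ≤ (t * ε) ^ α⁻¹}) ?_).trans ?_
  · rintro x ⟨h1, h2⟩
    have h3 : maxDist x 0 ^ α - ρ ^ α ≤ ε := (le_max_right _ _).trans h2
    have h4 := Real.rpow_le_rpow h0' h1 hα.le
    have ht1 : 0 < t - 1 := by linarith
    -- The choice of `ρ'` makes `ρ' ^ α - ρ ^ α = ρ ^ α / (t - 1)`. A margin at most `ε` beyond `ρ'`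
    -- then forces `maxDist x 0 ^ α ≤ t * ε`: the offset `ρ ^ α` costs only the factor `t`.
    have h5 : ρ ^ α ≤ (t - 1) * ε := by
      have h6 : ρ ^ α * (t / (t - 1)) - ρ ^ α ≤ ε := by rw [← hρ']; linarith
      have h7 : ρ ^ α * (t / (t - 1)) - ρ ^ α = ρ ^ α / (t - 1) := by
        field_simp
        ring
      rw [h7, div_le_iff₀ ht1] at h6
      linarith
    have h8 : maxDist x 0 ^ α ≤ t * ε := by linarith
    rw [Set.mem_ofPred_eq, Real.le_rpow_inv_iff_of_pos (maxDist_nonneg _ _) (by positivity) hα]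
    exact h8
  · rw [lebesgue_real_maxDist_le hs0 hs1, ← Real.rpow_natCast, ← Real.rpow_mul (by positivity)]
    -- The ball has volume `(t * ε) ^ (d / α)`, and `β ≤ d / α` with base at most `1`.
    refine Real.rpow_le_rpow_of_exponent_ge (by positivity) htε ?_
    rw [inv_mul_eq_div, le_div_iff₀ hα]
    linarith

/-! ### Parameters of the construction and membership in the class -/

/-- The numerical relations between the parameters of the construction. -/
structure GridSetup (d : ℕ) (ζ : Params) where
  (ρ ρ' θ b s t : ℝ)
  pos : 0 < d
  mem_α : ζ.α ∈ Set.Ioo (0 : ℝ) 1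
  pos_β : 0 < ζ.β
  one_lt_L : 1 < ζ.L
  mul_le : ζ.α * ζ.β ≤ d
  min_le : ζ.μmin ≤ 1
  mem_ρ : ρ ∈ Set.Ioo (0 : ℝ) 1
  lt_ρ' : ρ < ρ'
  -- The outer region alone has volume at least `b⁻¹`, so the density is at most `b`.
  ρ'_le : ρ' ≤ 1 - b⁻¹
  -- The empty shell between `ρ` and `ρ'` removes the points where the base margin has just left
  -- zero.
  ρ'_rpow : ρ' ^ ζ.α = ρ ^ ζ.α * (t / (t - 1))
  -- This bounds the mass of the region of zero margin.
  mul_ρ_le : b * ρ ≤ ζ.τ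
  mem_θ : 0 < θ ∧ θ ≤ 1 / 4
  one_lt_b : 1 < b
  b_le : b ≤ ζ.μmax
  pos_s : 0 < s
  -- The outer region uses `b * t ^ β = b ^ 2` of the margin constant; the bumps use `s`.
  add_le : b ^ 2 + s ≤ ζ.Cβ
  add_le' : b ^ 2 + s ≤ ζ.Cβ'
  one_lt_t : 1 < t
  t_rpow : t ^ ζ.β = b
  mul_θ_le : b * θ ≤ s * heightRatio ζ.α ^ ζ.β

namespace GridSetup

variable {ζ : Params} (G : GridSetup d ζ)

/-- The bumps on the grid with `q ^ d` cells. -/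
noncomputable def bumps (q : ℕ) (hq : 0 < q) : BumpFamily d (Fin d → Fin q) :=
  gridBumps d q ζ.α G.ρ G.θ G.mem_α G.mem_ρ G.mem_θ hq

/-- The support of the marginal for the grid with `q ^ d` cells. -/
def support (q : ℕ) : Set (Cube d) := gridSupport d q G.ρ' (G.ρ / q) G.θ

theorem inv_b_le (q : ℕ) : G.b⁻¹ ≤ (lebesgue d).real (G.support q) := by
  have h0 : 0 ≤ G.ρ' := (G.mem_ρ.1.trans G.lt_ρ').le
  have hb : 0 < G.b⁻¹ := inv_pos.2 (zero_lt_one.trans G.one_lt_b)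
  have h1 : G.ρ' ≤ 1 := by linarith [G.ρ'_le]
  have h2 := one_sub_le_lebesgue_gridSupport d q (G.ρ / q) G.θ h0 h1
  have h3 : G.ρ' ^ d ≤ G.ρ' := pow_le_of_le_one h0 h1 G.pos.ne'
  unfold support
  linarith [G.ρ'_le]

theorem lebesgue_support_pos (q : ℕ) : 0 < (lebesgue d).real (G.support q) :=
  (inv_pos.2 (zero_lt_one.trans G.one_lt_b)).trans_le (G.inv_b_le q)

theorem inv_lebesgue_support_le (q : ℕ) : ((lebesgue d).real (G.support q))⁻¹ ≤ G.b :=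
  inv_le_of_inv_le₀ (zero_lt_one.trans G.one_lt_b) (G.inv_b_le q)

/-- The marginal: the uniform distribution on the support. -/
noncomputable def marginal (q : ℕ) : Measure (Cube d) := cond (lebesgue d) (G.support q)

theorem isProbabilityMeasure_marginal (q : ℕ) : IsProbabilityMeasure (G.marginal q) := by
  have hp := isProbabilityMeasure_lebesgue d
  refine cond_isProbabilityMeasure fun h => ?_
  have := G.lebesgue_support_pos q
  rw [measureReal_def, h] at this
  simp at this

theorem marginal_real_le (q : ℕ) (E : Set (Cube d)) :
    (G.marginal q).real E ≤ G.b * (lebesgue d).real (G.support q ∩ E) :=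
  cond_real_le (measurableSet_gridSupport _ _ _ _ _) (G.inv_lebesgue_support_le q) E

theorem cell_nonneg (q : ℕ) : 0 ≤ G.ρ / q := div_nonneg G.mem_ρ.1.le (Nat.cast_nonneg _)

theorem mul_cell {q : ℕ} (hq : 0 < q) : q * (G.ρ / q) = G.ρ := by
  have : (0 : ℝ) < q := by exact_mod_cast hq
  field_simp

theorem lebesgue_piece {q : ℕ} (hq : 0 < q) (i : Fin d → Fin q) :
    (lebesgue d).real ((G.bumps q hq).piece i) = (G.θ * (G.ρ / q)) ^ d :=
  lebesgue_real_cellPiece (G.cell_nonneg q) ((G.mul_cell hq).le.trans G.mem_ρ.2.le) G.mem_θ.1.le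
    (by linarith [G.mem_θ.2]) i

theorem marginal_piece {q : ℕ} (hq : 0 < q) (i : Fin d → Fin q) :
    (G.marginal q).real ((G.bumps q hq).piece i) =
      ((lebesgue d).real (G.support q))⁻¹ * (G.θ * (G.ρ / q)) ^ d := by
  unfold marginal
  rw [real_cond_apply (S := G.support q) (measurableSet_gridSupport _ _ _ _ _), ← G.lebesgue_piece hq i]
  congr 2
  refine Set.inter_eq_right.2 fun x hx => Or.inr (Set.mem_iUnion.2 ⟨i, hx⟩)

theorem maxDist_le_of_mem_piece {q : ℕ} (hq : 0 < q) (i : Fin d → Fin q) {x : Cube d}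
    (hx : x ∈ (G.bumps q hq).piece i) : maxDist x 0 ≤ G.ρ := by
  have h := maxDist_le_of_mem_cellPiece (G.cell_nonneg q) G.mem_θ.1.le i hx
  refine (maxDist_zero_le_of_near (G.cell_nonneg q) i x (h.trans ?_)).trans (G.mul_cell hq).le
  exact mul_le_of_le_one_left (G.cell_nonneg q) (by linarith [G.mem_θ.2])

theorem margin_outer {q : ℕ} (hq : 0 < q) (σ : (Fin d → Fin q) → SignType) {x : Cube d}
    (hx : G.ρ' ≤ maxDist x 0) : (G.bumps q hq).margin σ x = cornerMargin ζ.α G.ρ x := by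
  refine (G.bumps q hq).margin_of_bump_eq_zero σ x fun i => ?_
  by_contra hne
  have h1 := maxDist_lt_of_bumpAt_ne_zero G.mem_α.1.le (G.cell_nonneg q) hne
  have h2 := maxDist_zero_le_of_near (G.cell_nonneg q) i x (by linarith [G.cell_nonneg q])
  rw [G.mul_cell hq] at h2
  linarith [G.lt_ρ']

theorem outer_le (ε : ℝ) (hε : 0 < ε) (htε : G.t * ε ≤ 1) :
    G.b * (lebesgue d).real {x | G.ρ' ≤ maxDist x 0 ∧ cornerMargin ζ.α G.ρ x ≤ ε} ≤
      G.b ^ 2 * ε ^ ζ.β := by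
  have ht := G.one_lt_t
  have h := lebesgue_real_outer_le (d := d) G.mem_α.1 G.mul_le G.mem_ρ.1 ht G.ρ'_rpow
    (G.mem_ρ.1.trans G.lt_ρ').le hε htε
  rw [Real.mul_rpow (by linarith) hε.le, G.t_rpow] at h
  refine (mul_le_mul_of_nonneg_left h (by linarith [G.one_lt_b])).trans (le_of_eq ?_)
  ring

/-- For such large `ε` the margin conditions hold trivially, as probabilities are at most `1`. -/
theorem one_le_of_lt_mul (ε : ℝ) (htε : 1 < G.t * ε) : 1 ≤ G.b ^ 2 * ε ^ ζ.β := by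
  have ht := G.one_lt_t
  have hb := G.one_lt_b
  have hε : 0 < ε := by
    by_contra! h
    nlinarith
  have h1 : 1 ≤ (G.t * ε) ^ ζ.β := Real.one_le_rpow htε.le G.pos_β.le
  rw [Real.mul_rpow (by linarith) hε.le, G.t_rpow] at h1
  nlinarith

/-- Small nonzero margins occur in the outer region and on the pieces carrying bumps. The latter
matter only if the height is at most `ε`. Their mass is then at most `b * q ^ (d - αβ) * (θ * ρ / q)
^ d ≤ b * θ * (ρ / q) ^ (αβ)`, and the smallness of `θ` makes this at most `s * height ^ β`. -/
theorem marginal_gap_le {q : ℕ} (hq : 0 < q) {m : ℕ} (hm : (m : ℝ) ≤ (q : ℝ) ^ (d - ζ.α * ζ.β))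
    {σ : (Fin d → Fin q) → SignType} (hσ : (signSupport σ).card = m) (ε : ℝ) (hε : 0 < ε) :
    (G.marginal q).real {x | 0 < |(G.bumps q hq).margin σ x| ∧ |(G.bumps q hq).margin σ x| ≤ ε} ≤
      (G.b ^ 2 + G.s) * ε ^ ζ.β := by
  have hp := isProbabilityMeasure_lebesgue d
  have hp' := G.isProbabilityMeasure_marginal q
  have hεβ : 0 < ε ^ ζ.β := Real.rpow_pos_of_pos hε _
  have hb : 0 < G.b := zero_lt_one.trans G.one_lt_b
  rcases lt_or_ge 1 (G.t * ε) with h | htε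
  · have := G.one_le_of_lt_mul ε h
    exact measureReal_le_one.trans (by nlinarith [G.pos_s])
  set B := G.bumps q hq with hB
  have hsplit : G.support q ∩ {x | 0 < |B.margin σ x| ∧ |B.margin σ x| ≤ ε} ⊆
      {x | G.ρ' ≤ maxDist x 0 ∧ cornerMargin ζ.α G.ρ x ≤ ε} ∪
        ⋃ i ∈ signSupport σ, {x | x ∈ B.piece i ∧ B.height ≤ ε} := by
    rintro x ⟨hxS | hxS, hx0, hxε⟩
    · refine Or.inl ⟨hxS, ?_⟩
      rw [G.margin_outer hq σ hxS] at hxε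
      exact (le_abs_self _).trans hxε
    · obtain ⟨i, hi⟩ := Set.mem_iUnion.1 hxS
      rw [B.margin_piece σ i x hi] at hx0 hxε
      have hne : σ i ≠ 0 := by
        intro h0
        simp [h0] at hx0
      refine Or.inr (Set.mem_iUnion₂.2 ⟨i, (mem_signSupport σ i).2 hne, hi, ?_⟩)
      have : ∀ s : SignType, s ≠ 0 → s = 1 ∨ s = -1 := by decide
      rcases this _ hne with h1 | h1 <;> rw [h1] at hxε
      · simpa [abs_of_pos B.height_pos] using hxε
      · simpa [abs_of_pos B.height_pos] using hxε
  have hpieces : G.b * (lebesgue d).real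
      (⋃ i ∈ signSupport σ, {x | x ∈ B.piece i ∧ B.height ≤ ε}) ≤ G.s * ε ^ ζ.β := by
    by_cases hv : B.height ≤ ε
    · have h1 : (lebesgue d).real (⋃ i ∈ signSupport σ, {x | x ∈ B.piece i ∧ B.height ≤ ε}) ≤
          m * (G.θ * (G.ρ / q)) ^ d := by
        refine (measureReal_biUnion_finset_le _ _).trans ?_
        simp only [hv, and_true]
        rw [← hσ, ← nsmul_eq_mul, ← Finset.sum_const]
        exact Finset.sum_le_sum fun i _ => (G.lebesgue_piece hq i).le
      have hq' : (0 : ℝ) < q := by exact_mod_cast hq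
      have hθd : G.θ ^ d ≤ G.θ :=
        pow_le_of_le_one G.mem_θ.1.le (by linarith [G.mem_θ.2]) G.pos.ne'
      have hρd : G.ρ ^ d ≤ G.ρ ^ (ζ.α * ζ.β) := by
        rw [← Real.rpow_natCast]
        exact Real.rpow_le_rpow_of_exponent_ge G.mem_ρ.1 G.mem_ρ.2.le G.mul_le
      have hheight : B.height ^ ζ.β =
          heightRatio ζ.α ^ ζ.β * (G.ρ ^ (ζ.α * ζ.β) * (q : ℝ) ^ (-(ζ.α * ζ.β))) := by
        change (heightRatio ζ.α * (G.ρ / q) ^ ζ.α) ^ ζ.β = _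
        rw [Real.mul_rpow (heightRatio_pos G.mem_α.1).le (Real.rpow_nonneg (G.cell_nonneg q) _),
          ← Real.rpow_mul (G.cell_nonneg q), Real.div_rpow G.mem_ρ.1.le hq'.le,
          Real.rpow_neg hq'.le, div_eq_mul_inv]
      have hqd : (q : ℝ) ^ (d - ζ.α * ζ.β) * ((q : ℝ) ^ d)⁻¹ = (q : ℝ) ^ (-(ζ.α * ζ.β)) := by
        rw [← Real.rpow_natCast, ← Real.rpow_neg hq'.le, ← Real.rpow_add hq']
        congr 1
        ring
      have hρ0 : 0 ≤ G.ρ := G.mem_ρ.1.le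
      have hθ0 : 0 ≤ G.θ := G.mem_θ.1.le
      calc G.b * _ ≤ G.b * ((q : ℝ) ^ (d - ζ.α * ζ.β) * (G.θ * (G.ρ / q)) ^ d) := by
            refine mul_le_mul_of_nonneg_left (h1.trans ?_) hb.le
            exact mul_le_mul_of_nonneg_right hm
              (pow_nonneg (mul_nonneg G.mem_θ.1.le (G.cell_nonneg q)) _)
        _ = (G.b * G.θ ^ d) * (G.ρ ^ d * (q : ℝ) ^ (-(ζ.α * ζ.β))) := by
            rw [← hqd, mul_pow, div_pow]
            ring
        _ ≤ (G.s * heightRatio ζ.α ^ ζ.β) *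
              (G.ρ ^ (ζ.α * ζ.β) * (q : ℝ) ^ (-(ζ.α * ζ.β))) := by
            have hr := Real.rpow_nonneg (heightRatio_pos G.mem_α.1).le ζ.β
            refine mul_le_mul ((mul_le_mul_of_nonneg_left hθd hb.le).trans G.mul_θ_le)
              (mul_le_mul_of_nonneg_right hρd (by positivity)) (by positivity)
              (mul_nonneg G.pos_s.le hr)
        _ = G.s * B.height ^ ζ.β := by
            rw [hheight]
            ring
        _ ≤ G.s * ε ^ ζ.β := mul_le_mul_of_nonneg_left
            (Real.rpow_le_rpow B.height_pos.le hv G.pos_β.le) G.pos_s.le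
    · simp only [hv, and_false]
      simp
      exact mul_nonneg G.pos_s.le hεβ.le
  calc _ ≤ G.b * (lebesgue d).real (G.support q ∩ _) := G.marginal_real_le q _
    _ ≤ G.b * ((lebesgue d).real {x | G.ρ' ≤ maxDist x 0 ∧ cornerMargin ζ.α G.ρ x ≤ ε} +
          (lebesgue d).real (⋃ i ∈ signSupport σ, {x | x ∈ B.piece i ∧ B.height ≤ ε})) :=
        mul_le_mul_of_nonneg_left ((measureReal_mono hsplit).trans (measureReal_union_le _ _)) hb.le
    _ ≤ (G.b ^ 2 + G.s) * ε ^ ζ.β := by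
        linarith [G.outer_le ε hε htε]

/-- Here zeros count, so all pieces are charged at once to the cube of side `ρ`, whose mass is at
most `τ`. Hence there is no restriction on the number of bumps. -/
theorem marginal_gap'_le {q : ℕ} (hq : 0 < q) (σ : (Fin d → Fin q) → SignType) (ε : ℝ)
    (hε : 0 < ε) :
    (G.marginal q).real {x | |(G.bumps q hq).margin σ x| ≤ ε} ≤
      ζ.τ + (G.b ^ 2 + G.s) * ε ^ ζ.β := by
  have hp := isProbabilityMeasure_lebesgue d
  have hp' := G.isProbabilityMeasure_marginal q
  have hεβ : 0 < ε ^ ζ.β := Real.rpow_pos_of_pos hε _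
  have hb : 0 < G.b := zero_lt_one.trans G.one_lt_b
  have hτ : 0 ≤ ζ.τ := (mul_nonneg hb.le G.mem_ρ.1.le).trans G.mul_ρ_le
  rcases lt_or_ge 1 (G.t * ε) with h | htε
  · have := G.one_le_of_lt_mul ε h
    exact measureReal_le_one.trans (by nlinarith [G.pos_s])
  set B := G.bumps q hq with hB
  have hsplit : G.support q ∩ {x | |B.margin σ x| ≤ ε} ⊆
      {x | G.ρ' ≤ maxDist x 0 ∧ cornerMargin ζ.α G.ρ x ≤ ε} ∪ {x | maxDist x 0 ≤ G.ρ} := by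
    rintro x ⟨hxS | hxS, hxε⟩
    · refine Or.inl ⟨hxS, ?_⟩
      rw [Set.mem_ofPred_eq, G.margin_outer hq σ hxS] at hxε
      exact (le_abs_self _).trans hxε
    · obtain ⟨i, hi⟩ := Set.mem_iUnion.1 hxS
      exact Or.inr (G.maxDist_le_of_mem_piece hq i hi)
  have hρd : G.ρ ^ d ≤ G.ρ := pow_le_of_le_one G.mem_ρ.1.le G.mem_ρ.2.le G.pos.ne'
  calc _ ≤ G.b * (lebesgue d).real (G.support q ∩ _) := G.marginal_real_le q _
    _ ≤ G.b * ((lebesgue d).real {x | G.ρ' ≤ maxDist x 0 ∧ cornerMargin ζ.α G.ρ x ≤ ε} +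
          (lebesgue d).real {x | maxDist x 0 ≤ G.ρ}) :=
        mul_le_mul_of_nonneg_left ((measureReal_mono hsplit).trans (measureReal_union_le _ _)) hb.le
    _ ≤ ζ.τ + (G.b ^ 2 + G.s) * ε ^ ζ.β := by
        rw [lebesgue_real_maxDist_le G.mem_ρ.1.le G.mem_ρ.2.le]
        have h1 := G.outer_le ε hε htε
        have h2 := (mul_le_mul_of_nonneg_left hρd hb.le).trans G.mul_ρ_le
        have h3 := mul_pos G.pos_s hεβ
        linarith

theorem model_mem_measureClass {q : ℕ} (hq : 0 < q) {m : ℕ}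
    (hm : (m : ℝ) ≤ (q : ℝ) ^ (d - ζ.α * ζ.β)) {σ : (Fin d → Fin q) → SignType}
    (hσ : (signSupport σ).card = m) :
    (G.bumps q hq).model (G.marginal q) (G.isProbabilityMeasure_marginal q) σ ∈
      measureClass d 2 ζ := by
  set B := G.bumps q hq with hB
  have hp' := G.isProbabilityMeasure_marginal q
  have hmarg : (B.model (G.marginal q) hp' σ).marginal = G.marginal q :=
    marginal_binaryModel _ _ _ _ _
  refine ⟨fun y x z => ?_, fun ε hε => ⟨?_, ?_⟩, ?_⟩
  · have h := abs_margin_gridBumps_sub_le G.mem_α G.mem_ρ G.mem_θ hq σ x z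
    have h0 : 0 ≤ dist x z ^ ζ.α := Real.rpow_nonneg dist_nonneg _
    have hle : |B.margin σ x - B.margin σ z| / 2 ≤ ζ.L * dist x z ^ ζ.α := by
      have h1 : |B.margin σ x - B.margin σ z| ≤ 2 * dist x z ^ ζ.α := h
      nlinarith [G.one_lt_L]
    refine le_trans (le_of_eq ?_) hle
    unfold BumpFamily.model
    rw [meanCost_binaryModel, meanCost_binaryModel, ← sub_div, abs_div, abs_two]
    congr 1
    split_ifs
    · rw [add_sub_add_left_eq_sub]
    · rw [add_sub_add_left_eq_sub, neg_sub_neg, abs_sub_comm]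
  · rw [hmarg]
    refine (measureReal_mono fun x hx => abs_le_of_gap_le _ _ _ _ _ x ε hx).trans
      ((G.marginal_gap_le hq hm hσ ε hε).trans ?_)
    exact mul_le_mul_of_nonneg_right G.add_le (Real.rpow_nonneg hε.le _)
  · rw [hmarg]
    refine (measureReal_mono fun x hx => ?_).trans
      ((G.marginal_gap'_le hq σ ε hε).trans ?_)
    · rw [Set.mem_ofPred_eq] at hx ⊢
      rwa [← gap'_binaryModel (G.marginal q) hp' (B.margin σ) (B.measurable_margin σ)
        (B.abs_margin_le σ) x]
    · have := mul_le_mul_of_nonneg_right G.add_le' (Real.rpow_nonneg hε.le ζ.β)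
      linarith
  · exact strongDensity_of_marginal_eq_cond _ (measurableSet_gridSupport _ _ _ _ _)
      (G.lebesgue_support_pos q) G.min_le ((G.inv_lebesgue_support_le q).trans G.b_le) hmarg

end GridSetup

/-! ### Choice of the parameters -/

theorem nonempty_gridSetup (ζ : Params) (hζ : ζ ∈ paramSet) (hL : 1 < ζ.L) (hCβ : 1 < ζ.Cβ)
    (hCβ' : 1 < ζ.Cβ') (hαβ : ζ.α * ζ.β ≤ (d : ℝ)) (hμmin : ζ.μmin < ζ.τ) (hμmax : 1 < ζ.μmax) :
    Nonempty (GridSetup d ζ) := by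
  obtain ⟨hα, -, hβ, -, -, hτ, hmin, -⟩ := hζ
  have hτ0 : 0 < ζ.τ := hmin.1.trans hμmin
  -- Dimension zero is excluded by `0 < αβ ≤ d`.
  have hd : 0 < d := by
    have h1 : (0 : ℝ) < d := (mul_pos hα.1 hβ).trans_le hαβ
    exact_mod_cast h1
  obtain ⟨c, hc1, hcβ, hcβ', hcμ⟩ : ∃ c : ℝ, 1 < c ∧ c ≤ ζ.Cβ ∧ c ≤ ζ.Cβ' ∧ c ≤ ζ.μmax :=
    ⟨min ζ.Cβ (min ζ.Cβ' ζ.μmax), lt_min hCβ (lt_min hCβ' hμmax), min_le_left _ _,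
      (min_le_right _ _).trans (min_le_left _ _), (min_le_right _ _).trans (min_le_right _ _)⟩
  obtain ⟨b, hb1, hbc⟩ : ∃ b : ℝ, 1 < b ∧ b ^ 2 < c := by
    -- With `b = c ^ (1 / 4)`, `b ^ 2 = √c < c` leaves the positive margin `s = c - b ^ 2` for the
    -- bumps.
    refine ⟨√√c, ?_, ?_⟩
    · rw [Real.lt_sqrt zero_le_one, one_pow, Real.lt_sqrt zero_le_one]
      simpa using hc1
    · rw [Real.sq_sqrt (Real.sqrt_nonneg _), Real.sqrt_lt' (by linarith)]
      nlinarith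
  have hb0 : 0 < b := by linarith
  have hbinv : b⁻¹ < 1 := inv_lt_one_of_one_lt₀ hb1
  have hbinv0 : 0 < b⁻¹ := inv_pos.2 hb0
  obtain ⟨t, ht1, htβ⟩ : ∃ t : ℝ, 1 < t ∧ t ^ ζ.β = b :=
    ⟨b ^ ζ.β⁻¹, Real.one_lt_rpow hb1 (inv_pos.2 hβ), Real.rpow_inv_rpow hb0.le hβ.ne'⟩
  have ht0 : 0 < t - 1 := by linarith
  have htpos : 0 < t := by linarith
  obtain ⟨ρ', hρ'0, hρ'b, hρ'τ⟩ : ∃ r : ℝ, 0 < r ∧ r ≤ 1 - b⁻¹ ∧ r ≤ ζ.τ / b :=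
    ⟨min (1 - b⁻¹) (ζ.τ / b), lt_min (by linarith) (by positivity), min_le_left _ _,
      min_le_right _ _⟩
  have hu0 : 0 < (t - 1) / t := by positivity
  have hu1 : (t - 1) / t < 1 := by rw [div_lt_one htpos]; linarith
  have hv0 : 0 < ((t - 1) / t) ^ ζ.α⁻¹ := Real.rpow_pos_of_pos hu0 _
  have hv1 : ((t - 1) / t) ^ ζ.α⁻¹ < 1 := Real.rpow_lt_one hu0.le hu1 (inv_pos.2 hα.1)
  have hlt : ρ' * ((t - 1) / t) ^ ζ.α⁻¹ < ρ' := mul_lt_of_lt_one_right hρ'0 hv1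
  have hr : 0 < heightRatio ζ.α ^ ζ.β := Real.rpow_pos_of_pos (heightRatio_pos hα.1) _
  have hs : 0 < c - b ^ 2 := by linarith
  exact ⟨
    { ρ := ρ' * ((t - 1) / t) ^ ζ.α⁻¹
      ρ' := ρ'
      θ := min (1 / 4) ((c - b ^ 2) * heightRatio ζ.α ^ ζ.β / b)
      b := b
      s := c - b ^ 2
      t := t
      pos := hd
      mem_α := hα
      pos_β := hβ
      one_lt_L := hL
      mul_le := hαβ
      min_le := hmin.2.le
      mem_ρ := ⟨by positivity, by linarith⟩
      lt_ρ' := hlt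
      ρ'_le := hρ'b
      ρ'_rpow := by
        rw [Real.mul_rpow hρ'0.le hv0.le, Real.rpow_inv_rpow hu0.le hα.1.ne']
        field_simp
      mul_ρ_le := by
        rw [le_div_iff₀ hb0] at hρ'τ
        nlinarith
      mem_θ := ⟨lt_min (by norm_num) (by positivity), min_le_left _ _⟩
      one_lt_b := hb1
      b_le := by nlinarith
      pos_s := hs
      add_le := by linarith
      add_le' := by linarith
      one_lt_t := ht1
      t_rpow := htβ
      mul_θ_le := by
        refine (mul_le_mul_of_nonneg_left (min_le_right _ _) hb0.le).trans (le_of_eq ?_)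
        field_simp }⟩

/-! ### Choice of the mesh and the rate -/

/-- The number of bumps can be taken of the order of `y`. -/
theorem exists_bump_count {y : ℝ} (hy : 1 ≤ y) :
    ∃ k : ℕ, y / 2 ≤ (k : ℝ) + 1 ∧ (k : ℝ) + 1 ≤ y ∧ 2 * (k : ℝ) ≤ y := by
  have h1 := Nat.floor_le (show 0 ≤ y / 2 by linarith)
  have h2 := Nat.lt_floor_add_one (y / 2)
  rcases lt_or_ge y 2 with h | h
  · exact ⟨0, by norm_num; linarith, by norm_num; linarith, by norm_num; linarith⟩
  · exact ⟨⌊y / 2⌋₊, h2.le, by linarith, by linarith⟩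

namespace GridSetup

variable {ζ : Params}

/-- The most bumps permitted by the margin condition are used, up to a factor `2`: `k + 1` lies
between `y / 2` and `y` for `y = q ^ (d - αβ)`. The factor `16` is this `2` times the `8` of the
averaging argument. -/
theorem exists_excessRisk_ge_of_grid (G : GridSetup d ζ) {q : ℕ} (hq : 0 < q)
    (hn : 8 * (n : ℝ) ≤ (q : ℝ) ^ (2 * ζ.α + d)) (A : ActiveLearner d 2 n) :
    ∃ P ∈ measureClass d 2 ζ,
      heightRatio ζ.α * G.ρ ^ ζ.α * (G.θ * G.ρ) ^ d / 16 * (q : ℝ) ^ (-(ζ.α * (ζ.β + 1))) ≤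
        A.expectedExcessRisk P := by
  have hp := isProbabilityMeasure_lebesgue d
  have hq' : (0 : ℝ) < q := by exact_mod_cast hq
  have hq1 : (1 : ℝ) ≤ q := by exact_mod_cast hq
  have hα := G.mem_α.1
  have hρ := G.mem_ρ.1
  have hθ := G.mem_θ.1
  have hr := heightRatio_pos hα
  have hcard : (Fintype.card (Fin d → Fin q) : ℝ) = (q : ℝ) ^ (d : ℝ) := by
    simp
  obtain ⟨k, hk1, hk2, hk3⟩ := exists_bump_count
    (Real.one_le_rpow hq1 (sub_nonneg.2 G.mul_le))
  have hyK : (q : ℝ) ^ (d - ζ.α * ζ.β) ≤ (q : ℝ) ^ (d : ℝ) :=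
    Real.rpow_le_rpow_of_exponent_le hq1 (by linarith [mul_pos hα G.pos_β])
  set B := G.bumps q hq with hB
  have hheight : B.height = heightRatio ζ.α * (G.ρ ^ ζ.α * (q : ℝ) ^ (-ζ.α)) := by
    change heightRatio ζ.α * (G.ρ / q) ^ ζ.α = _
    rw [Real.div_rpow hρ.le hq'.le, Real.rpow_neg hq'.le, div_eq_mul_inv]
  have hqα : 0 < (q : ℝ) ^ (-ζ.α) := Real.rpow_pos_of_pos hq' _
  have hle : B.height ≤ (q : ℝ) ^ (-ζ.α) := by
    rw [hheight, ← mul_assoc]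
    exact mul_le_of_le_one_left hqα.le (mul_le_one₀ (heightRatio_le_one hα)
      (Real.rpow_nonneg hρ.le _) (Real.rpow_le_one hρ.le G.mem_ρ.2.le hα.le))
  -- Squared heights are at most `q ^ (-2α)`, so a budget of `q ^ (2α + d) / 8` is spread too thinly
  -- over `q ^ d` cells.
  have hbudget : 8 * (n * B.height ^ 2) ≤ Fintype.card (Fin d → Fin q) := by
    rw [hcard]
    calc 8 * (n * B.height ^ 2) = 8 * n * B.height ^ 2 := by ring
      _ ≤ (q : ℝ) ^ (2 * ζ.α + d) * ((q : ℝ) ^ (-ζ.α)) ^ 2 :=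
          mul_le_mul hn (pow_le_pow_left₀ B.height_pos.le hle 2) (sq_nonneg _)
            (Real.rpow_nonneg hq'.le _)
      _ = (q : ℝ) ^ (d : ℝ) := by
          rw [← Real.rpow_natCast, ← Real.rpow_mul hq'.le, ← Real.rpow_add hq']
          congr 1
          push_cast
          ring
  obtain ⟨σ, hσ, hrisk⟩ := B.exists_large_excessRisk (G.marginal q)
    (G.isProbabilityMeasure_marginal q) _ (G.marginal_piece hq) k
    (by
      have : (k : ℝ) + 1 ≤ Fintype.card (Fin d → Fin q) := by rw [hcard]; linarith
      exact_mod_cast this)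
    (by
      have : 2 * (k : ℝ) ≤ Fintype.card (Fin d → Fin q) := by rw [hcard]; linarith
      exact_mod_cast this) hbudget A
  refine ⟨_, G.model_mem_measureClass hq (m := k + 1) (by push_cast; exact hk2)
    (mem_signPatterns.1 hσ), le_trans ?_ hrisk⟩
  -- Conditioning on the support can only increase the mass of a piece.
  have hinv : 1 ≤ ((lebesgue d).real (G.support q))⁻¹ :=
    (one_le_inv₀ (G.lebesgue_support_pos q)).2 measureReal_le_one
  have hw : (G.θ * (G.ρ / q)) ^ d ≤
      ((lebesgue d).real (G.support q))⁻¹ * (G.θ * (G.ρ / q)) ^ d :=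
    le_mul_of_one_le_left (pow_nonneg (mul_nonneg hθ.le (G.cell_nonneg q)) _) hinv
  have hmw := mul_le_mul hk1 hw (pow_nonneg (mul_nonneg hθ.le (G.cell_nonneg q)) _)
    (by positivity)
  have e : (q : ℝ) ^ (-(ζ.α * (ζ.β + 1))) =
      (q : ℝ) ^ (-ζ.α) * ((q : ℝ) ^ (d - ζ.α * ζ.β) * ((q : ℝ) ^ d)⁻¹) := by
    rw [← Real.rpow_natCast, ← Real.rpow_neg hq'.le, ← Real.rpow_add hq', ← Real.rpow_add hq']
    congr 1
    ring
  calc _ = B.height * ((q : ℝ) ^ (d - ζ.α * ζ.β) / 2 * (G.θ * (G.ρ / q)) ^ d / 8) := by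
        rw [e, hheight, mul_pow, mul_pow, div_pow]
        ring
    _ ≤ _ := mul_le_mul_of_nonneg_left (by linarith) B.height_pos.le

/-- Take the smallest `q` with `8n ≤ q ^ (2α + d)`. The bound to be rounded up is at least `1`, so
rounding at most doubles it; this gives the factor `2 ^ (-α(β + 1))` in `C`. -/
theorem exists_excessRisk_ge (G : GridSetup d ζ) :
    ∃ C : ℝ, 0 < C ∧ ∀ n : ℕ, 1 ≤ n → ∀ A : ActiveLearner d 2 n,
    ∃ P ∈ measureClass d 2 ζ,
      C * (1 / (n : ℝ)) ^ (ζ.α * (ζ.β + 1) / (2 * ζ.α + (d : ℝ))) ≤ A.expectedExcessRisk P := by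
  have hα := G.mem_α.1
  have hr := heightRatio_pos hα
  have hρα := Real.rpow_pos_of_pos G.mem_ρ.1 ζ.α
  have hθρ : 0 < (G.θ * G.ρ) ^ d := pow_pos (mul_pos G.mem_θ.1 G.mem_ρ.1) _
  have hD : 0 < 2 * ζ.α + (d : ℝ) := by positivity
  have hE : 0 < ζ.α * (ζ.β + 1) := mul_pos hα (by linarith [G.pos_β])
  refine ⟨heightRatio ζ.α * G.ρ ^ ζ.α * (G.θ * G.ρ) ^ d / 16 *
    (2 ^ (-(ζ.α * (ζ.β + 1))) * 8 ^ (-(ζ.α * (ζ.β + 1) / (2 * ζ.α + (d : ℝ))))),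
    by positivity, fun n hn A => ?_⟩
  have hn' : (1 : ℝ) ≤ n := by exact_mod_cast hn
  have hX1 : 1 ≤ (8 * (n : ℝ)) ^ (2 * ζ.α + (d : ℝ))⁻¹ :=
    Real.one_le_rpow (by linarith) (inv_pos.2 hD).le
  have hceil := Nat.le_ceil ((8 * (n : ℝ)) ^ (2 * ζ.α + (d : ℝ))⁻¹)
  have hceil' := Nat.ceil_lt_add_one (zero_le_one.trans hX1)
  have hq : 0 < ⌈(8 * (n : ℝ)) ^ (2 * ζ.α + (d : ℝ))⁻¹⌉₊ := Nat.ceil_pos.2 (by linarith)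
  have hq' : (0 : ℝ) < ⌈(8 * (n : ℝ)) ^ (2 * ζ.α + (d : ℝ))⁻¹⌉₊ := by exact_mod_cast hq
  obtain ⟨P, hP, h⟩ := G.exists_excessRisk_ge_of_grid hq (n := n) (by
    refine le_trans (le_of_eq ?_) (Real.rpow_le_rpow (by positivity) hceil hD.le)
    rw [Real.rpow_inv_rpow (by positivity) hD.ne']) A
  refine ⟨P, hP, le_trans ?_ h⟩
  rw [mul_assoc]
  refine mul_le_mul_of_nonneg_left ?_ (by positivity)
  calc _ = (2 * (8 * (n : ℝ)) ^ (2 * ζ.α + (d : ℝ))⁻¹) ^ (-(ζ.α * (ζ.β + 1))) := by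
        rw [Real.mul_rpow (by norm_num) (by positivity), ← Real.rpow_mul (by positivity),
          mul_assoc, Real.mul_rpow (by norm_num) (by positivity), one_div,
          Real.inv_rpow (by positivity), ← Real.rpow_neg (by positivity)]
        congr 2 <;> congr 1 <;> ring
    _ ≤ _ := Real.rpow_le_rpow_of_nonpos hq' (by linarith) (by linarith)

end GridSetup

end CostSensitive

theorem theorem2 (d : ℕ) (ζ : CostSensitive.Params) (hζ : ζ ∈ CostSensitive.paramSet)
    (hL : 1 < ζ.L) (hCβ : 1 < ζ.Cβ) (hCβ' : 1 < ζ.Cβ')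
    (hαβ : ζ.α * ζ.β ≤ (d : ℝ)) (hμmin : ζ.μmin < ζ.τ) (hμmax : 1 < ζ.μmax) :
    ∃ C C' : ℝ, 0 < C ∧ 0 < C' ∧ ∀ n : ℕ, 1 ≤ n →
      ((min
          (C * max
            ((ζ.τ / (n : ℝ)) ^ (ζ.α * (ζ.β + 1) / (2 * ζ.α + (d : ℝ))))
            ((1 / (n : ℝ)) ^ (ζ.α * (ζ.β + 1) / (2 * ζ.α + (d : ℝ) - ζ.α * ζ.β))))
          (C' * max
            ((1 / (n : ℝ)) ^ (ζ.α * (ζ.β + 1) / (2 * ζ.α + (d : ℝ))))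
            ((1 / ζ.τ) ^ (ζ.α * (ζ.β + 1) / (2 * ζ.α + (d : ℝ))) *
              (1 / (n : ℝ)) ^ (ζ.α * (ζ.β + 1) / (2 * ζ.α + (d : ℝ) - ζ.α * ζ.β)))) : ℝ) : EReal)
        ≤ ⨅ A : CostSensitive.ActiveLearner d 2 n,
            ⨆ P ∈ CostSensitive.measureClass d 2 ζ, ((A.expectedExcessRisk P : ℝ) : EReal) := by
  obtain ⟨G⟩ := CostSensitive.nonempty_gridSetup ζ hζ hL hCβ hCβ' hαβ hμmin hμmax
  obtain ⟨C, hC, h⟩ := G.exists_excessRisk_ge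
  refine ⟨C, C, hC, hC, fun n hn => le_iInf fun A => ?_⟩
  obtain ⟨P, hP, hle⟩ := h n hn A
  -- It suffices to bound the first argument of the minimum, with the same constant `C`.
  refine le_iSup₂_of_le P hP (EReal.coe_le_coe_iff.2 ((min_le_left _ _).trans (le_trans ?_ hle)))
  refine mul_le_mul_of_nonneg_left ?_ hC.le
  have hα := G.mem_α.1
  have hn' : (1 : ℝ) ≤ n := by exact_mod_cast hn
  have hαβ0 : 0 < ζ.α * ζ.β := mul_pos hα G.pos_β
  have hE : 0 ≤ ζ.α * (ζ.β + 1) := by linarith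
  have hτ := hζ.2.2.2.2.2.1
  refine max_le ?_ ?_
  · refine Real.rpow_le_rpow (div_nonneg hτ.1 (by linarith)) ?_ (div_nonneg hE (by linarith))
    exact div_le_div_of_nonneg_right hτ.2 (by linarith)
  -- Subtracting `αβ` from the denominator enlarges the exponent, and the base `1 / n` is at most
  -- `1`.
  · refine Real.rpow_le_rpow_of_exponent_ge (by positivity)
      ((div_le_one (by linarith)).2 hn') ?_
    exact div_le_div_of_nonneg_left hE (by linarith) (by linarith)
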